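/- Let $c>0$ and $\gamma=\gamma(c)=\tfrac12\bigl(1+\sqrt{1+2c^4}\bigr)$. For $k\ge 0$ and $\xi>0$ let $$\varphi_k^\gamma(\xi)=\frac{\sqrt2\,i^\gamma (c^{-4})^{i\xi}\,\Gamma(\gamma+i\xi)^2}{\Gamma(i\xi)\,\Gamma(k+\gamma+\frac12)\sqrt{k!\,\Gamma(k+2\gamma)}}\,S_k\bigl(\xi^2;\gamma,\gamma,\tfrac12\bigr)$$ be the eigenstates of the relativistic pseudoharmonic oscillator, where $$S_k(\xi^2;a,b,d)=(a+b)_k(a+d)_k\,{}_3F_2(-k,a+i\xi,a-i\xi;a+b,a+d;1)$$ is the continuous dual Hahn polynomial. For $\sigma=2(\gamma+m)$ and $z\in\mathbb D=\{|z|<1\}$ let $$\Phi_k^{\sigma,m}(z)=\sqrt{\frac{(\sigma-2m-1)\,\Gamma(\sigma-m)\,k!}{\pi\, m!\,\Gamma(\sigma-2m+k)}}\;\frac{(-1)^k\,\bar z^{\,m-k}}{(1-|z|^2)^m}\;P_k^{(m-k,\,\sigma-2m-1)}(1-2|z|^2)$$ (with $P_k^{(\alpha,\beta)}$ the Jacobi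 polynomial; the formula is extended continuously to $z=0$), $$\mathcal N_{\sigma,m}(z)=\frac{\sigma-2m-1}{\pi(1-|z|^2)^\sigma},\qquad \varphi_{z,\gamma,m}=\mathcal N_{\sigma,m}(z)^{-1/2}\sum_{k\ge0}\overline{\Phi_k^{\sigma,m}(z)}\,\varphi_k^\gamma ,$$ and let $\mathcal B^{\mathrm{II}}_{c,m}[f](z)=\mathcal N_{\sigma,m}(z)^{1/2}\int_0^\infty f(\xi)\,\overline{\varphi_{z,\gamma,m}(\xi)}\,d\xi$ be the associated coherent state transform. Let $\mathcal A^{2\gamma}(\mathbb D)$ be the Bergman space of holomorphic functions $\phi$ on $\mathbb D$ with $$\|\phi\|^2=\int_{\mathbb D}|\phi(z)|^2(1-|z|^2)^{2\gamma-2}\,d\nu(z)<\infty ,$$ where $\nu$ is Lebesgue measure. **Corollary.** For $m=0$ the coherent states are well defined: for every $z\in\mathbb D$ the series for $\varphi_{z,\gamma,0}$ converges at every $\xi>0$, its sum lies in $L^2(\mathbb R_+,d\xi)$, and it also converges to this sum in $L^2(\mathbb R_+,d\xi)$. The transform $\mathcal B^{\mathrm{II}}_{c,0}$ is a linear isometry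 of $L^2(\mathbb R_+)$ **onto** $\mathcal A^{2\gamma}(\mathbb D)$, and for all $f\in L^2(\mathbb R_+)$ and $z\in\mathbb D$ $$\mathcal B^{\mathrm{II}}_{c,0}[f](z)=\Bigl(\frac{2\gamma-1}{\pi}\Bigr)^{1/2}\frac{(-i)^\gamma}{(1-z)^\gamma}\,\frac{\sqrt2}{\Gamma(\gamma+\frac12)\sqrt{\Gamma(2\gamma)}}\int_0^\infty (c^{-4})^{-i\xi}\,\frac{\Gamma(\gamma-i\xi)^2}{(1-z)^{i\xi}\,\Gamma(-i\xi)}\;{}_2F_1\Bigl(\gamma-i\xi,\tfrac12-i\xi;\gamma+\tfrac12;z\Bigr) f(\xi)\,d\xi ,$$ where the integral converges absolutely and all powers are principal. -/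

import Mathlib

open MeasureTheory Set Filter Topology
open scoped ComplexConjugate

noncomputable section

namespace RelativisticBargmann

/-- The Lebesgue measure on the half-line of positive reals. -/
abbrev halfLine : Measure ℝ := volume.restrict (Ioi (0 : ℝ))

/-- The measure `(1 - |z|²) ^ (σ - 2) dν(z)` on the open unit disk (and zero outside of it). -/
def diskMeasure (σ : ℝ) : Measure ℂ :=
  (volume.restrict (Metric.ball (0 : ℂ) 1)).withDensity
    (fun z => ENNReal.ofReal ((1 - ‖z‖ ^ 2) ^ (σ - 2)))

/-- The weighted Bergman space: holomorphic functions on the unit disk that are square integrable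
for `(1 - |z|²) ^ (σ - 2) dν(z)`, with the norm of that `L²` space. An element is an `L²` class
that has a holomorphic representative. -/
def bergmanSpace (σ : ℝ) : Submodule ℂ (Lp ℂ 2 (diskMeasure σ)) where
  carrier := {u | ∃ φ : ℂ → ℂ, DifferentiableOn ℂ φ (Metric.ball (0 : ℂ) 1) ∧
    u =ᵐ[diskMeasure σ] φ}
  zero_mem' := ⟨fun _ => 0, differentiableOn_const 0, Lp.coeFn_zero _ _ _⟩
  add_mem' := by
    rintro u v ⟨φ, hφ, hu⟩ ⟨ψ, hψ, hv⟩
    exact ⟨φ + ψ, hφ.add hψ, (Lp.coeFn_add u v).trans (hu.add hv)⟩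
  smul_mem' := by
    rintro a u ⟨φ, hφ, hu⟩
    exact ⟨a • φ, hφ.const_smul a, (Lp.coeFn_smul a u).trans (hu.const_smul a)⟩

/-- The rising factorial `(a)_n`. -/
def poch (a : ℂ) (n : ℕ) : ℂ := (ascPochhammer ℂ n).eval a

/-- The Jacobi polynomial `P_n^{(α, β)}(x)`, for arbitrary real parameters, by
`P_n^{(α, β)}(x) = (1 / n!) ∑ s, C(n, s) (n + α + β + 1)_s (α + s + 1)_{n - s} ((x - 1) / 2) ^ s`. -/
def jacobi (n : ℕ) (α β x : ℝ) : ℝ :=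
  (1 / (n.factorial : ℝ)) * ∑ s ∈ Finset.range (n + 1),
    (n.choose s : ℝ) * (ascPochhammer ℝ s).eval ((n : ℝ) + α + β + 1) *
      (ascPochhammer ℝ (n - s)).eval (α + (s : ℝ) + 1) * ((x - 1) / 2) ^ s

/-- The continuous dual Hahn polynomial `S_n(ξ²; a, b, d)`, that is
`(a + b)_n (a + d)_n ₃F₂(-n, a + iξ, a - iξ; a + b, a + d; 1)`. -/
def dualHahn (n : ℕ) (ξ : ℝ) (a b d : ℝ) : ℂ :=
  poch ((a : ℂ) + b) n * poch ((a : ℂ) + d) n * ∑ j ∈ Finset.range (n + 1),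
    (poch (-(n : ℂ)) j * poch ((a : ℂ) + Complex.I * ξ) j * poch ((a : ℂ) - Complex.I * ξ) j) /
      (poch ((a : ℂ) + b) j * poch ((a : ℂ) + d) j * (j.factorial : ℂ))

/-- The parameter `γ = γ(c) = (1 + √(1 + 2 c⁴)) / 2`. -/
def gam (c : ℝ) : ℝ := (1 + Real.sqrt (1 + 2 * c ^ 4)) / 2

/-- The eigenstates `φ_k^γ(ξ)` of the relativistic pseudoharmonic oscillator. -/
def eigenstate (c : ℝ) (k : ℕ) (ξ : ℝ) : ℂ :=
  (Real.sqrt 2 : ℂ) * Complex.I ^ (gam c : ℂ) * (((c ^ 4)⁻¹ : ℝ) : ℂ) ^ (Complex.I * ξ) *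
      Complex.Gamma (gam c + Complex.I * ξ) ^ 2 * (Complex.Gamma (Complex.I * ξ))⁻¹ /
      ((Real.Gamma (k + gam c + 1 / 2) *
        Real.sqrt ((k.factorial : ℝ) * Real.Gamma (k + 2 * gam c)) : ℝ) : ℂ) *
    dualHahn k ξ (gam c) (gam c) (1 / 2)

/-- The basis functions `Φ_k^{σ, m}(z)` of the `m`-th `L²` eigenspace of the `σ`-weight Maass
Laplacian on the disk. (At `z = 0` the Lean convention for `0 ^ (m - k)` gives the value of the
continuous extension.) -/
def landauBasis (σ : ℝ) (m k : ℕ) (z : ℂ) : ℂ :=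
  (Real.sqrt ((σ - 2 * m - 1) * Real.Gamma (σ - m) * (k.factorial : ℝ) /
      (Real.pi * (m.factorial : ℝ) * Real.Gamma (σ - 2 * m + k))) : ℂ) *
    ((-1) ^ k * (conj z) ^ ((m : ℤ) - (k : ℤ)) / (((1 - ‖z‖ ^ 2) ^ m : ℝ) : ℂ)) *
    (jacobi k ((m : ℝ) - k) (σ - 2 * m - 1) (1 - 2 * ‖z‖ ^ 2) : ℂ)

/-- The normalization factor `N_{σ, m}(z) = (σ - 2m - 1) / (π (1 - |z|²) ^ σ)`. -/
def normFactor (σ : ℝ) (m : ℕ) (z : ℂ) : ℝ :=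
  (σ - 2 * m - 1) / (Real.pi * (1 - ‖z‖ ^ 2) ^ σ)

/-- The weight `σ = 2 (γ + m)`. -/
def weight (c : ℝ) (m : ℕ) : ℝ := 2 * (gam c + m)

/-- The `k`-th term of the superposition that defines the coherent state, a function of `ξ`. -/
def coherentTerm (c : ℝ) (m : ℕ) (z : ℂ) (k : ℕ) (ξ : ℝ) : ℂ :=
  (((normFactor (weight c m) m z) ^ (-(1 / 2) : ℝ) : ℝ) : ℂ) *
    (conj (landauBasis (weight c m) m k z) * eigenstate c k ξ)

/-- The wave function `ξ ↦ φ_{z, γ, m}(ξ)` of the coherent state labelled by `z`, with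
`σ = 2 (γ + m)`: the sum of `N_{σ, m}(z)^{-1/2} conj (Φ_k^{σ, m}(z)) φ_k^γ(ξ)` over `k`. -/
def coherentState (c : ℝ) (m : ℕ) (z : ℂ) (ξ : ℝ) : ℂ := ∑' k : ℕ, coherentTerm c m z k ξ

/-- The coherent state transform `N_{σ, m}(z)^{1/2} ⟨f, φ_{z, γ, m}⟩` in `L²(ℝ₊)`, the scalar
product being linear in its first argument. -/
def bargmannTransform (c : ℝ) (m : ℕ) (f : ℝ → ℂ) (z : ℂ) : ℂ :=
  (((normFactor (weight c m) m z) ^ (1 / 2 : ℝ) : ℝ) : ℂ) *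
    ∫ ξ, f ξ * conj (coherentState c m z ξ) ∂halfLine

/-- The integral kernel `(c⁻⁴)^{-iξ} Γ(γ - iξ)² / ((1 - z)^{iξ} Γ(-iξ)) *
₂F₁(γ - iξ, 1/2 - iξ; γ + 1/2; z)`, with principal powers. -/
def gaussKernel (c : ℝ) (z : ℂ) (ξ : ℝ) : ℂ :=
  (((c ^ 4)⁻¹ : ℝ) : ℂ) ^ (-(Complex.I * ξ)) *
    (Complex.Gamma (gam c - Complex.I * ξ) ^ 2 /
      ((1 - z) ^ (Complex.I * ξ) * Complex.Gamma (-(Complex.I * ξ)))) *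
    ordinaryHypergeometric (gam c - Complex.I * ξ) (1 / 2 - Complex.I * ξ)
      ((gam c : ℂ) + 1 / 2) z

end RelativisticBargmann

end

/-!
Put `γ = gam c`. The transform maps the eigenstate `φ_k` to the normalized monomial `Φ_k`, which for
`m = 0` is `√((2γ - 1) Γ(2γ + k) / (π Γ(2γ) k!)) z ^ k`. Everything follows once both families
are known to be orthonormal and complete, together with a closed form for `∑ Φ_k(z) conj φ_k(ξ)`.

*Eigenstates.* Up to a common factor of modulus squared `2 |Γ(γ + iξ)² / Γ(iξ)|²`, the eigenstates
are continuous dual Hahn polynomials. Their orthogonality reduces, by expanding in the products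
`(γ + iξ)_j (γ - iξ)_j` and summing with the Chu-Vandermonde identity, to Barnes' integral
`∫ |Γ(a + iξ) Γ(b + iξ) / Γ(iξ)|² dξ = Γ(a + b) Γ(a + 1/2) Γ(b + 1/2) / 2` over the half-line
(`integrableOn_and_integral_weight`). Since `1 / |Γ(iξ)|² = ξ sinh(πξ) / π`, this is a
first moment of a product of Gamma functions on a vertical line. Times an exponential,
`Γ(a + iξ) Γ(b - iξ)` is the Fourier transform of Euler's beta integrand on the imaginary axis, so
that Parseval's identity turns the first moment into a classical beta integral.

For completeness, a function `f` orthogonal to all eigenstates satisfies `∫ G ξ ^ (2n) dξ = 0` for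
all `n`, where `G` is the product of `f` with the conjugate of the common factor. The latter decays
exponentially, hence the Fourier transform of the even extension of `G` is analytic in a strip with
vanishing Taylor series at `0`, and `G = 0` (`ae_eq_zero_of_even_moments_eq_zero`).

*Disk.* Polar coordinates and Cauchy's formula on circles show that integrating a holomorphic
function against `conj z ^ k` gives a multiple of its `k`-th Taylor coefficient
(`integral_conj_pow_mul`). This yields the orthonormality of the `Φ_k`, and that a function of the
Bergman space is the pointwise sum of its expansion (`hasSum_inner_diskLp_mul`).

*Kernel.* The generating function
`∑ S_n z ^ n / ((γ + 1/2)_n n!) = (1 - z) ^ (-γ - iξ) ₂F₁(γ - iξ, 1/2 - iξ; γ + 1/2; z)`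
(`hasSum_dualHahn`) sums the series of the coherent state at every point. The series also converges
in `L²` because `∑ |Φ_k(z)|²` is a binomial series, and the two sums agree almost everywhere
(`ae_eq_of_hasSum_of_hasSum`). The same comparison identifies the abstract isometry `φ_k ↦ Φ_k` with
the transform, and its range with the Bergman space.
-/

namespace RelativisticBargmann

/-! ### Rising factorials and the Chu–Vandermonde identity -/

@[simp] lemma poch_zero (a : ℂ) : poch a 0 = 1 := by simp [poch]

lemma poch_succ (a : ℂ) (n : ℕ) : poch a (n + 1) = poch a n * (a + n) := by
  simp [poch, ascPochhammer_succ_eval]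

lemma poch_eq_prod (a : ℂ) (n : ℕ) : poch a n = ∏ j ∈ Finset.range n, (a + j) := by
  induction n with
  | zero => simp
  | succ n ih => rw [poch_succ, ih, Finset.prod_range_succ]

lemma poch_add (a : ℂ) (m n : ℕ) : poch a (m + n) = poch a m * poch (a + m) n := by
  simp only [poch_eq_prod, Finset.prod_range_add, Nat.cast_add, add_assoc]

lemma poch_ne_zero {a : ℂ} (ha : 0 < a.re) (n : ℕ) : poch a n ≠ 0 := by
  rw [poch_eq_prod, Finset.prod_ne_zero_iff]
  intro j _ h
  have := congrArg Complex.re h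
  simp only [Complex.add_re, Complex.natCast_re, Complex.zero_re] at this
  have : (0 : ℝ) ≤ j := j.cast_nonneg
  linarith

lemma conj_poch (a : ℂ) (n : ℕ) : conj (poch a n) = poch (conj a) n := by
  simp [poch_eq_prod, map_prod]

lemma poch_reflect (a : ℂ) (n : ℕ) : poch a n = (-1) ^ n * poch (1 - a - n) n := by
  have h : (-1 : ℂ) ^ n = ∏ _j ∈ Finset.range n, (-1 : ℂ) := by simp
  rw [poch_eq_prod, poch_eq_prod, ← Finset.prod_range_reflect, h, ← Finset.prod_mul_distrib]
  refine Finset.prod_congr rfl fun j hj => ?_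
  have hj' : j + 1 ≤ n := Finset.mem_range.1 hj
  rw [show n - 1 - j = n - (j + 1) by omega, Nat.cast_sub hj']
  push_cast
  ring

lemma poch_neg_self (n : ℕ) : poch (-(n : ℂ)) n = (-1) ^ n * n.factorial := by
  rw [poch_reflect, show (1 : ℂ) - -n - n = 1 by ring]
  simp [poch, ascPochhammer_eval_one]

lemma poch_neg_eq_zero {k n : ℕ} (h : k < n) : poch (-(k : ℂ)) n = 0 := by
  rw [poch_eq_prod, Finset.prod_eq_zero_iff]
  exact ⟨k, Finset.mem_range.2 h, by ring⟩

lemma poch_neg_add (l k : ℕ) :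
    poch (-((l + k : ℕ) : ℂ)) l * k.factorial = (-1) ^ l * (l + k).factorial := by
  induction l with
  | zero => simp
  | succ l ih =>
    have h1 : poch (-((l + 1 + k : ℕ) : ℂ)) (l + 1) =
        -((l + 1 + k : ℕ) : ℂ) * poch (-((l + k : ℕ) : ℂ)) l := by
      rw [add_comm l 1, poch_add]
      simp only [poch_succ, poch_zero, Nat.cast_zero, add_zero, one_mul]
      congr 2
      push_cast
      ring
    rw [h1, mul_assoc, ih, show l + 1 + k = l + k + 1 by ring, Nat.factorial_succ]
    push_cast
    ring

/-- The Chu–Vandermonde identity `(a + b)_n = ∑ C(n, i) (a)_i (b)_{n - i}`. -/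
lemma poch_add_eq_sum (a b : ℂ) (n : ℕ) : poch (a + b) n =
    ∑ p ∈ Finset.HasAntidiagonal.antidiagonal n, (n.choose p.1 : ℂ) * (poch a p.1 * poch b p.2) := by
  induction n with
  | zero => simp
  | succ n ih =>
    rw [Finset.sum_antidiagonal_choose_succ_mul fun i j => poch a i * poch b j,
      ← Finset.sum_add_distrib, poch_succ, ih, Finset.sum_mul]
    refine Finset.sum_congr rfl fun p hp => ?_
    have hp' : p.1 + p.2 = n := Finset.HasAntidiagonal.mem_antidiagonal.1 hp
    rw [poch_succ, poch_succ, ← Nat.choose_symm_of_eq_add hp'.symm, ← hp']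
    push_cast
    ring

/-- The terminating Gauss sum `₂F₁(-n, b; c; 1) = (c - b)_n / (c)_n`, free of denominators. -/
lemma sum_neg_one_pow_choose_poch (b c : ℂ) (n : ℕ) :
    ∑ p ∈ Finset.HasAntidiagonal.antidiagonal n,
      (-1) ^ p.1 * (n.choose p.1 : ℂ) * (poch b p.1 * poch (c + p.1) p.2) = poch (c - b) n := by
  rw [poch_reflect (c - b), show 1 - (c - b) - n = b + (1 - c - n) by ring, poch_add_eq_sum,
    Finset.mul_sum]
  refine Finset.sum_congr rfl fun p hp => ?_
  have hp' : p.1 + p.2 = n := Finset.HasAntidiagonal.mem_antidiagonal.1 hp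
  rw [poch_reflect (c + p.1), show 1 - (c + p.1) - p.2 = 1 - c - n by rw [← hp']; push_cast; ring,
    ← hp', pow_add]
  ring

/-! ### Continuous dual Hahn polynomials -/

/-- The continuous dual Hahn polynomial expanded in the products `(a + iξ)_l (a - iξ)_l`, with
polynomial coefficients. -/
lemma dualHahn_eq_sum (n : ℕ) (ξ : ℝ) {a b d : ℝ} (hab : 0 < a + b) (had : 0 < a + d) :
    dualHahn n ξ a b d = ∑ p ∈ Finset.HasAntidiagonal.antidiagonal n,
      (-1) ^ p.1 * (n.choose p.1 : ℂ) * (poch (a + b + p.1) p.2 * poch (a + d + p.1) p.2) *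
        (poch (a + Complex.I * ξ) p.1 * poch (a - Complex.I * ξ) p.1) := by
  rw [dualHahn, Finset.Nat.sum_antidiagonal_eq_sum_range_succ_mk, Finset.mul_sum]
  refine Finset.sum_congr rfl fun l hl => ?_
  obtain ⟨k, rfl⟩ := Nat.exists_eq_add_of_le (Nat.lt_succ_iff.1 (Finset.mem_range.1 hl))
  have h1 : poch ((a : ℂ) + b) l ≠ 0 := poch_ne_zero (by simpa using hab) l
  have h2 : poch ((a : ℂ) + d) l ≠ 0 := poch_ne_zero (by simpa using had) l
  have h3 : (l.factorial : ℂ) ≠ 0 := Nat.cast_ne_zero.2 l.factorial_ne_zero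
  have h4 : (k.factorial : ℂ) ≠ 0 := Nat.cast_ne_zero.2 k.factorial_ne_zero
  have h5 : ((l + k).choose l : ℂ) * l.factorial * k.factorial = (l + k).factorial := by
    rw [Nat.choose_symm_add]
    exact_mod_cast Nat.add_choose_mul_factorial_mul_factorial l k
  have h6 := poch_neg_add l k
  rw [← h5] at h6
  have h7 : poch (-((l + k : ℕ) : ℂ)) l = (-1) ^ l * ((l + k).choose l * l.factorial) :=
    mul_right_cancel₀ h4 (by rw [h6]; ring)
  rw [h7, poch_add, poch_add, Nat.add_sub_cancel_left]
  field_simp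

lemma conj_dualHahn (n : ℕ) (ξ a b d : ℝ) : conj (dualHahn n ξ a b d) = dualHahn n ξ a b d := by
  simp only [dualHahn, map_mul, map_sum, map_div₀, conj_poch, map_add, map_sub, map_neg,
    Complex.conj_ofReal, Complex.conj_I, map_natCast, neg_mul, sub_neg_eq_add, ← sub_eq_add_neg,
    map_div₀]
  congr 1
  exact Finset.sum_congr rfl fun j _ => by rw [mul_right_comm]

/-- The coefficients of the Cauchy product of `₂F₁(α, d - β; d; t)` and `(1 - t)^{-β}`. -/
lemma sum_poch_mul_poch (α β d : ℂ) (hd : 0 < d.re) (n : ℕ) :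
    ∑ p ∈ Finset.HasAntidiagonal.antidiagonal n,
      poch α p.1 * poch (d - β) p.1 / (poch d p.1 * p.1.factorial) *
        (poch β p.2 / p.2.factorial) =
      (∑ p ∈ Finset.HasAntidiagonal.antidiagonal n, (-1) ^ p.1 * (n.choose p.1 : ℂ) *
        (poch (α + β + p.1) p.2 * poch (d + p.1) p.2) * (poch α p.1 * poch β p.1)) /
        (poch d n * n.factorial) := by
  have hf (l : ℕ) : (l.factorial : ℂ) ≠ 0 := Nat.cast_ne_zero.2 l.factorial_ne_zero
  have hp' (l : ℕ) : poch d l ≠ 0 := poch_ne_zero hd l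
  have hc (l k : ℕ) : ((l + k).choose l : ℂ) * l.factorial * k.factorial = (l + k).factorial := by
    rw [Nat.choose_symm_add]
    exact_mod_cast Nat.add_choose_mul_factorial_mul_factorial l k
  have key (i j : ℕ) : poch α i * poch (d - β) i / (poch d i * i.factorial) *
      (poch β j / j.factorial) = ∑ q ∈ Finset.HasAntidiagonal.antidiagonal i,
        (-1) ^ q.1 * poch β q.1 * poch α q.1 / (poch d q.1 * q.1.factorial) *
          (poch (α + q.1) q.2 / q.2.factorial * (poch β j / j.factorial)) := by
    rw [← sum_neg_one_pow_choose_poch β d i, Finset.mul_sum, Finset.sum_div, Finset.sum_mul]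
    refine Finset.sum_congr rfl fun q hq => ?_
    obtain rfl : q.1 + q.2 = i := Finset.HasAntidiagonal.mem_antidiagonal.1 hq
    have h1 := hf q.1
    have h2 := hf q.2
    have h3 := hp' q.1
    have h4 : poch (d + q.1) q.2 ≠ 0 := right_ne_zero_of_mul (poch_add d q.1 q.2 ▸ hp' _)
    have h5 := hf j
    rw [← hc, poch_add d, poch_add α]
    have h6 : (((q.1 + q.2).choose q.1 : ℕ) : ℂ) ≠ 0 :=
      Nat.cast_ne_zero.2 (Nat.choose_pos (Nat.le_add_right _ _)).ne'
    field_simp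
  simp_rw [key]
  rw [Finset.sum_sigma', Finset.sum_div]
  have hre : ∀ p ∈ Finset.HasAntidiagonal.antidiagonal n,
      (-1) ^ p.1 * (n.choose p.1 : ℂ) * (poch (α + β + p.1) p.2 * poch (d + p.1) p.2) *
        (poch α p.1 * poch β p.1) / (poch d n * n.factorial) =
      ∑ q ∈ Finset.HasAntidiagonal.antidiagonal p.2, (-1) ^ p.1 * poch β p.1 *
        poch α p.1 / (poch d p.1 * p.1.factorial) *
          (poch (α + p.1) q.1 / q.1.factorial * (poch β q.2 / q.2.factorial)) := by
    intro p hp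
    obtain rfl : p.1 + p.2 = n := Finset.HasAntidiagonal.mem_antidiagonal.1 hp
    have h1 : poch (α + β + p.1) p.2 / p.2.factorial =
        ∑ q ∈ Finset.HasAntidiagonal.antidiagonal p.2,
          poch (α + p.1) q.1 / q.1.factorial * (poch β q.2 / q.2.factorial) := by
      rw [show α + β + p.1 = α + p.1 + β by ring, poch_add_eq_sum, Finset.sum_div]
      refine Finset.sum_congr rfl fun q hq => ?_
      obtain h : q.1 + q.2 = p.2 := Finset.HasAntidiagonal.mem_antidiagonal.1 hq
      rw [← h, ← hc]
      have h2 := hf q.1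
      have h3 := hf q.2
      have h6 : (((q.1 + q.2).choose q.1 : ℕ) : ℂ) ≠ 0 :=
        Nat.cast_ne_zero.2 (Nat.choose_pos (Nat.le_add_right _ _)).ne'
      field_simp
    rw [← Finset.mul_sum, ← h1, ← hc, poch_add d]
    have h2 := hf p.1
    have h3 := hf p.2
    have h4 := hp' p.1
    have h5 : poch (d + p.1) p.2 ≠ 0 := right_ne_zero_of_mul (poch_add d p.1 p.2 ▸ hp' _)
    have h6 : (((p.1 + p.2).choose p.1 : ℕ) : ℂ) ≠ 0 :=
      Nat.cast_ne_zero.2 (Nat.choose_pos (Nat.le_add_right _ _)).ne'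
    field_simp
  -- both sides are now sums over triples with sum `n`, grouped from the left and from the right
  rw [Finset.sum_congr rfl hre, Finset.sum_sigma']
  refine Finset.sum_nbij' (fun x => ⟨(x.2.1, x.2.2 + x.1.2), (x.2.2, x.1.2)⟩)
    (fun x => ⟨(x.1.1 + x.2.1, x.2.2), (x.1.1, x.2.1)⟩) ?_ ?_ ?_ ?_ ?_
  · rintro ⟨⟨a, b⟩, ⟨c, e⟩⟩ h
    simp only [Finset.mem_sigma, Finset.HasAntidiagonal.mem_antidiagonal] at h ⊢
    exact ⟨by omega, trivial⟩
  · rintro ⟨⟨a, b⟩, ⟨c, e⟩⟩ h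
    simp only [Finset.mem_sigma, Finset.HasAntidiagonal.mem_antidiagonal] at h ⊢
    exact ⟨by omega, trivial⟩
  · rintro ⟨⟨a, b⟩, ⟨c, e⟩⟩ h
    simp only [Finset.mem_sigma, Finset.HasAntidiagonal.mem_antidiagonal] at h ⊢
    obtain ⟨h1, h2⟩ := h
    subst h2
    rfl
  · rintro ⟨⟨a, b⟩, ⟨c, e⟩⟩ h
    simp only [Finset.mem_sigma, Finset.HasAntidiagonal.mem_antidiagonal] at h ⊢
    obtain ⟨h1, h2⟩ := h
    subst h2
    rfl
  · rintro ⟨⟨a, b⟩, ⟨c, e⟩⟩ _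
    rfl

lemma ringChoose_eq_poch (β : ℂ) (n : ℕ) :
    Ring.choose (β + n - 1) n = poch β n / n.factorial := by
  have h := Ring.factorial_nsmul_multichoose_eq_ascPochhammer β n
  rw [Polynomial.ascPochhammer_smeval_eq_eval, nsmul_eq_mul] at h
  rw [Ring.choose, show β + n - 1 - n + 1 = β by ring, poch, ← h,
    mul_div_cancel_left₀ _ (Nat.cast_ne_zero.2 n.factorial_ne_zero)]

lemma norm_summable_and_hasSum_one_sub_cpow (β : ℂ) {z : ℂ} (hz : ‖z‖ < 1) :
    Summable (fun n : ℕ => ‖poch β n / n.factorial * z ^ n‖) ∧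
      HasSum (fun n : ℕ => poch β n / n.factorial * z ^ n) ((1 - z) ^ (-β)) := by
  have hp := Complex.one_div_one_sub_cpow_hasFPowerSeriesOnBall_zero β
  have hz' : z ∈ Metric.eball (0 : ℂ) 1 := by
    rw [← ENNReal.ofReal_one, Metric.eball_ofReal]
    simpa using hz
  have h1 := FormalMultilinearSeries.summable_norm_apply _ (Metric.eball_subset_eball hp.r_le hz')
  have h2 := hp.hasSum hz'
  simp only [FormalMultilinearSeries.ofScalars_apply_eq, ringChoose_eq_poch, smul_eq_mul,
    zero_add, one_div] at h1 h2
  rw [Complex.cpow_neg]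
  exact ⟨h1, h2⟩

lemma norm_summable_and_hasSum_ordinaryHypergeometric {a b d : ℂ} (ha : 0 < a.re) (hb : 0 < b.re)
    (hd : 0 < d.re) {z : ℂ} (hz : ‖z‖ < 1) :
    Summable (fun n : ℕ => ‖poch a n * poch b n / (poch d n * n.factorial) * z ^ n‖) ∧
      HasSum (fun n : ℕ => poch a n * poch b n / (poch d n * n.factorial) * z ^ n)
        (ordinaryHypergeometric a b d z) := by
  have hne {w : ℂ} (hw : 0 < w.re) (k : ℕ) : (k : ℂ) ≠ -w := fun h => by
    have := congrArg Complex.re h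
    simp only [Complex.natCast_re, Complex.neg_re] at this
    have : (0 : ℝ) ≤ k := k.cast_nonneg
    linarith
  have hr := ordinaryHypergeometricSeries_radius_eq_one ℂ a b d
    fun k => ⟨hne ha k, hne hb k, hne hd k⟩
  have hz' : z ∈ Metric.eball (0 : ℂ) (ordinaryHypergeometricSeries ℂ a b d).radius := by
    rw [hr, ← ENNReal.ofReal_one, Metric.eball_ofReal]
    simpa using hz
  have h1 := FormalMultilinearSeries.summable_norm_apply _ hz'
  have h2 := FormalMultilinearSeries.hasSum _ hz'
  have he (n : ℕ) : (ordinaryHypergeometricSeries ℂ a b d n fun _ => z) =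
      poch a n * poch b n / (poch d n * n.factorial) * z ^ n := by
    rw [ordinaryHypergeometricSeries_apply_eq, smul_eq_mul]
    simp only [poch, div_eq_mul_inv, mul_inv]
    ring
  simp only [he] at h1 h2
  exact ⟨h1, h2⟩

/-- The generating function of the polynomials `S_n(ξ²; a, a, d)`. Both the polynomials and the sum
are even in `ξ`, which for the right-hand side is Euler's transformation of `₂F₁`. -/
lemma hasSum_dualHahn (ξ : ℝ) {a d : ℝ} (ha : 0 < a) (hd : 0 < d) {z : ℂ} (hz : ‖z‖ < 1) :
    HasSum (fun n : ℕ => dualHahn n ξ a a d / (poch (a + d) n * n.factorial) * z ^ n)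
      ((1 - z) ^ (-(a + Complex.I * ξ)) *
        ordinaryHypergeometric (a - Complex.I * ξ) (d - Complex.I * ξ) (a + d : ℂ) z) := by
  obtain ⟨h1, h2⟩ := norm_summable_and_hasSum_one_sub_cpow (a + Complex.I * ξ) hz
  obtain ⟨h3, h4⟩ := norm_summable_and_hasSum_ordinaryHypergeometric
    (a := a - Complex.I * ξ) (b := d - Complex.I * ξ) (d := a + d) (by simpa) (by simpa)
    (by simpa using add_pos ha hd) hz
  have h5 := summable_norm_sum_mul_antidiagonal_of_summable_norm h3 h1
  have h6 := tsum_mul_tsum_eq_tsum_sum_antidiagonal_of_summable_norm h3 h1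
  rw [h2.tsum_eq, h4.tsum_eq, mul_comm] at h6
  rw [h6]
  refine h5.of_norm.hasSum.congr_fun fun n => ?_
  have h7 := sum_poch_mul_poch (a - Complex.I * ξ) (a + Complex.I * ξ) (a + d)
    (by simpa using add_pos ha hd) n
  rw [dualHahn_eq_sum n ξ (add_pos ha ha) (add_pos ha hd)]
  have h8 : (∑ p ∈ Finset.HasAntidiagonal.antidiagonal n,
      (-1) ^ p.1 * (n.choose p.1 : ℂ) * (poch (a + a + p.1) p.2 * poch (a + d + p.1) p.2) *
        (poch (a + Complex.I * ξ) p.1 * poch (a - Complex.I * ξ) p.1)) =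
      ∑ p ∈ Finset.HasAntidiagonal.antidiagonal n, (-1) ^ p.1 * (n.choose p.1 : ℂ) *
        (poch (a - Complex.I * ξ + (a + Complex.I * ξ) + p.1) p.2 * poch (a + d + p.1) p.2) *
          (poch (a - Complex.I * ξ) p.1 * poch (a + Complex.I * ξ) p.1) := by
    refine Finset.sum_congr rfl fun p _ => ?_
    rw [show (a : ℂ) - Complex.I * ξ + (a + Complex.I * ξ) = a + a by ring]
    ring
  rw [h8, ← h7, Finset.sum_mul]
  refine Finset.sum_congr rfl fun p hp => ?_
  obtain rfl : p.1 + p.2 = n := Finset.HasAntidiagonal.mem_antidiagonal.1 hp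
  rw [show (a : ℂ) + d - (a + Complex.I * ξ) = d - Complex.I * ξ by ring, pow_add]
  ring

/-! ### Horizontal contour shifts and Euler's beta integral on rotated rays -/

lemma integrable_exp_neg_mul_abs {δ : ℝ} (hδ : 0 < δ) :
    Integrable fun u : ℝ => Real.exp (-(δ * |u|)) := by
  rw [← integrableOn_univ, ← Iic_union_Ioi (a := (0 : ℝ))]
  refine IntegrableOn.union ?_ ?_
  · refine (integrableOn_exp_mul_Iic hδ 0).congr_fun (fun u hu => ?_) measurableSet_Iic
    simp only [abs_of_nonpos (mem_Iic.1 hu), mul_neg, neg_neg]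
  · refine (integrableOn_exp_mul_Ioi (neg_lt_zero.2 hδ) 0).congr_fun (fun u hu => ?_)
      measurableSet_Ioi
    simp only [abs_of_pos (mem_Ioi.1 hu), neg_mul]

/-- The integral of a holomorphic function with exponential decay does not change when the line of
integration is moved from `ℝ` to `ℝ + iθ`. -/
lemma integral_add_mul_I_eq {f : ℂ → ℂ} {θ δ C : ℝ} (hδ : 0 < δ)
    (hf : DifferentiableOn ℂ f {z | z.im ∈ uIcc 0 θ})
    (hC : ∀ u v : ℝ, v ∈ uIcc 0 θ → ‖f (u + v * Complex.I)‖ ≤ C * Real.exp (-(δ * |u|))) :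
    ∫ u : ℝ, f (u + θ * Complex.I) = ∫ u : ℝ, f u := by
  have hint : ∀ v ∈ uIcc 0 θ, Integrable fun u : ℝ => f (u + v * Complex.I) := by
    intro v hv
    refine ((integrable_exp_neg_mul_abs hδ).const_mul C).mono' ?_ (.of_forall fun u => hC u v hv)
    refine Continuous.aestronglyMeasurable ?_
    exact hf.continuousOn.comp_continuous (by fun_prop) fun u => by simpa using hv
  have h0 : ∀ u : ℝ, f u = f (u + (0 : ℝ) * Complex.I) := fun u => by simp
  simp_rw [h0]
  have hT (v : ℝ) (hv : v ∈ uIcc 0 θ) :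
      Tendsto (fun T : ℝ => ∫ u in -T..T, f (u + v * Complex.I)) atTop
        (𝓝 (∫ u : ℝ, f (u + v * Complex.I))) :=
    intervalIntegral_tendsto_integral (hint v hv) tendsto_neg_atTop_atBot tendsto_id
  have hvert (g : ℝ → ℝ) (hg : ∀ T, |g T| = |T|) :
      Tendsto (fun T : ℝ => ∫ v in (0 : ℝ)..θ, f (g T + v * Complex.I)) atTop (𝓝 0) := by
    have hb (T : ℝ) : ‖∫ v in (0 : ℝ)..θ, f (g T + v * Complex.I)‖ ≤
        C * Real.exp (-(δ * |T|)) * |θ - 0| :=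
      intervalIntegral.norm_integral_le_of_norm_le_const fun v hv =>
        hg T ▸ hC (g T) v (uIoc_subset_uIcc hv)
    refine squeeze_zero_norm hb ?_
    have h1 : Tendsto (fun T : ℝ => -(δ * |T|)) atTop atBot :=
      tendsto_neg_atTop_atBot.comp (tendsto_abs_atTop_atTop.const_mul_atTop hδ)
    simpa using ((Real.tendsto_exp_atBot.comp h1).const_mul C).mul_const |θ - 0|
  have hrect (T : ℝ) : (∫ u in -T..T, f (u + θ * Complex.I)) =
      (∫ u in -T..T, f (u + (0 : ℝ) * Complex.I)) +
        Complex.I * (∫ v in (0 : ℝ)..θ, f ((T : ℝ) + v * Complex.I)) -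
        Complex.I * (∫ v in (0 : ℝ)..θ, f ((-T : ℝ) + v * Complex.I)) := by
    have h := Complex.integral_boundary_rect_eq_zero_of_differentiableOn f ((-T : ℝ) : ℂ)
      (T + θ * Complex.I) (hf.mono fun z hz => by simpa using hz.2)
    simp only [Complex.ofReal_re, Complex.ofReal_im, Complex.add_re, Complex.add_im,
      Complex.mul_re, Complex.mul_im, Complex.I_re, Complex.I_im, mul_zero, mul_one,
      sub_zero, add_zero, zero_add, smul_eq_mul] at h
    linear_combination -h
  have hlim := ((hT 0 left_mem_uIcc).add ((hvert id fun _ => rfl).const_mul Complex.I)).sub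
    ((hvert Neg.neg fun T => abs_neg T).const_mul Complex.I)
  simp only [mul_zero, add_zero, sub_zero] at hlim
  refine tendsto_nhds_unique (hT θ right_mem_uIcc) (hlim.congr fun T => ?_)
  rw [hrect T]
  rfl

lemma one_add_exp_mem_slitPlane {z : ℂ} (hz : |z.im| < Real.pi) :
    1 + Complex.exp z ∈ Complex.slitPlane := by
  rw [Complex.mem_slitPlane_iff]
  rcases eq_or_ne z.im 0 with h | h
  · left
    simp only [Complex.add_re, Complex.one_re, Complex.exp_re, h, Real.cos_zero, mul_one]
    positivity
  · right
    simp only [Complex.add_im, Complex.one_im, Complex.exp_im, zero_add]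
    refine mul_ne_zero (Real.exp_ne_zero _) ?_
    obtain ⟨h1, h2⟩ := abs_lt.1 hz
    rwa [Ne, Real.sin_eq_zero_iff_of_lt_of_lt h1 h2]

lemma cos_half_mul_le_norm_one_add_exp (u v : ℝ) :
    Real.cos (v / 2) * (1 + Real.exp u) ≤ ‖1 + Complex.exp (u + v * Complex.I)‖ := by
  refine le_of_sq_le_sq ?_ (norm_nonneg _)
  have h1 : ‖1 + Complex.exp (u + v * Complex.I)‖ ^ 2 =
      1 + 2 * Real.exp u * Real.cos v + Real.exp u ^ 2 := by
    rw [← Complex.normSq_eq_norm_sq, Complex.normSq_apply]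
    simp only [Complex.add_re, Complex.add_im, Complex.one_re, Complex.one_im, Complex.exp_re,
      Complex.exp_im, Complex.ofReal_re, Complex.ofReal_im, Complex.mul_re, Complex.mul_im,
      Complex.I_re, Complex.I_im, mul_zero, mul_one, sub_zero, add_zero, zero_add]
    linear_combination Real.exp u ^ 2 * Real.sin_sq_add_cos_sq v
  have h2 : Real.cos v = 2 * Real.cos (v / 2) ^ 2 - 1 := by
    rw [← Real.cos_two_mul]; ring_nf
  rw [h1, h2]
  have h3 : 0 ≤ 1 - Real.cos (v / 2) ^ 2 := by
    linarith [Real.sin_sq_add_cos_sq (v / 2), sq_nonneg (Real.sin (v / 2))]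
  nlinarith [mul_nonneg h3 (sq_nonneg (1 - Real.exp u))]

lemma exp_mul_one_add_exp_rpow_le {a p : ℝ} (ha : 0 < a) (hp : a < p) (u : ℝ) :
    Real.exp (a * u) * (1 + Real.exp u) ^ (-p) ≤ Real.exp (-(min a (p - a) * |u|)) := by
  have hu := Real.exp_pos u
  rcases le_total 0 u with h | h
  · have h1 : (1 + Real.exp u) ^ (-p) ≤ Real.exp u ^ (-p) :=
      Real.rpow_le_rpow_of_nonpos hu (by linarith) (by linarith)
    rw [← Real.exp_mul] at h1
    refine (mul_le_mul_of_nonneg_left h1 (Real.exp_pos _).le).trans ?_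
    rw [← Real.exp_add, Real.exp_le_exp, abs_of_nonneg h]
    nlinarith [min_le_right a (p - a)]
  · have h1 : (1 + Real.exp u) ^ (-p) ≤ 1 :=
      Real.rpow_le_one_of_one_le_of_nonpos (by linarith) (by linarith)
    refine (mul_le_mul_of_nonneg_left h1 (Real.exp_pos _).le).trans ?_
    rw [mul_one, Real.exp_le_exp, abs_of_nonpos h]
    nlinarith [min_le_left a (p - a)]

/-- The integrand of Euler's beta integral after the substitution `t = exp ζ`. -/
noncomputable def betaIntegrand (s : ℂ) (p : ℝ) (ζ : ℂ) : ℂ :=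
  Complex.exp (s * ζ) * (1 + Complex.exp ζ) ^ (-(p : ℂ))

lemma norm_betaIntegrand_le {s : ℂ} {p θ : ℝ} (hs : 0 < s.re) (hp : s.re < p)
    (hθ : |θ| < Real.pi) {u v : ℝ} (hv : |v| ≤ |θ|) :
    ‖betaIntegrand s p (u + v * Complex.I)‖ ≤
      Real.exp (|s.im| * |θ|) * Real.cos (θ / 2) ^ (-p) *
        Real.exp (-(min s.re (p - s.re) * |u|)) := by
  have hc : 0 < Real.cos (θ / 2) := Real.cos_pos_of_mem_Ioo (by
    obtain ⟨h1, h2⟩ := abs_lt.1 hθ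
    constructor <;> linarith)
  have hcv : Real.cos (θ / 2) ≤ Real.cos (v / 2) := by
    rw [← Real.cos_abs (θ / 2), ← Real.cos_abs (v / 2)]
    refine Real.cos_le_cos_of_nonneg_of_le_pi (abs_nonneg _) ?_ ?_
    · rw [abs_div, abs_two]; linarith [Real.pi_pos]
    · rw [abs_div, abs_div, abs_two]; linarith
  have hu : 0 < 1 + Real.exp u := by positivity
  have h1 : ‖(1 + Complex.exp (u + v * Complex.I)) ^ (-(p : ℂ))‖ ≤
      Real.cos (θ / 2) ^ (-p) * (1 + Real.exp u) ^ (-p) := by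
    rw [← Complex.ofReal_neg, Complex.norm_cpow_real, ← Real.mul_rpow hc.le hu.le]
    exact Real.rpow_le_rpow_of_nonpos (mul_pos hc hu)
      ((mul_le_mul_of_nonneg_right hcv hu.le).trans (cos_half_mul_le_norm_one_add_exp u v))
      (by linarith)
  have h2 : ‖Complex.exp (s * (u + v * Complex.I))‖ ≤
      Real.exp (|s.im| * |θ|) * Real.exp (s.re * u) := by
    rw [Complex.norm_exp, ← Real.exp_add, Real.exp_le_exp]
    simp only [Complex.mul_re, Complex.add_re, Complex.ofReal_re, Complex.I_re, mul_zero,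
      Complex.ofReal_im, Complex.I_im, mul_one, sub_zero, add_zero, Complex.add_im,
      Complex.mul_im, zero_add]
    have : -(s.im * v) ≤ |s.im| * |θ| := (neg_le_abs _).trans
      (by rw [abs_mul]; exact mul_le_mul_of_nonneg_left hv (abs_nonneg _))
    linarith
  rw [betaIntegrand, norm_mul]
  calc _ ≤ Real.exp (|s.im| * |θ|) * Real.exp (s.re * u) *
        (Real.cos (θ / 2) ^ (-p) * (1 + Real.exp u) ^ (-p)) :=
      mul_le_mul h2 h1 (norm_nonneg _) (by positivity)
    _ = Real.exp (|s.im| * |θ|) * Real.cos (θ / 2) ^ (-p) *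
        (Real.exp (s.re * u) * (1 + Real.exp u) ^ (-p)) := by ring
    _ ≤ _ := mul_le_mul_of_nonneg_left (exp_mul_one_add_exp_rpow_le hs hp u) (by positivity)

lemma differentiableAt_betaIntegrand (s : ℂ) (p : ℝ) {z : ℂ} (hz : |z.im| < Real.pi) :
    DifferentiableAt ℂ (betaIntegrand s p) z := by
  unfold betaIntegrand
  refine DifferentiableAt.mul (by fun_prop) ?_
  exact DifferentiableAt.cpow_const (by fun_prop) (one_add_exp_mem_slitPlane hz)

lemma integral_betaIntegrand_ofReal {s : ℂ} {p : ℝ} (hs : 0 < s.re) (hp : s.re < p) :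
    ∫ u : ℝ, betaIntegrand s p u =
      Complex.Gamma s * Complex.Gamma (p - s) / Complex.Gamma p := by
  have hps : 0 < ((p : ℂ) - s).re := by simpa using hp
  have h1 := Complex.betaIntegral_eq_Gamma_mul_div s (p - s) hs hps
  rw [add_sub_cancel] at h1
  rw [← h1, Complex.betaIntegral, intervalIntegral.integral_of_le zero_le_one,
    integral_Ioc_eq_integral_Ioo, ← Real.range_sigmoid, ← image_univ,
    integral_image_eq_integral_abs_deriv_smul MeasurableSet.univ
      (fun x _ => (Real.hasDerivAt_sigmoid x).hasDerivWithinAt) Real.sigmoid_injective.injOn,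
    setIntegral_univ]
  refine integral_congr_ae (.of_forall fun u => ?_)
  have hu : 0 < 1 + Real.exp u := by positivity
  have e1 : Real.sigmoid u = Real.exp u * (1 + Real.exp u)⁻¹ := by
    rw [Real.sigmoid_def, Real.exp_neg]
    field_simp
    ring
  have e2 : 1 - Real.sigmoid u = (1 + Real.exp u)⁻¹ := by
    rw [e1]
    field_simp
    ring
  have e3 : ((Real.sigmoid u : ℝ) : ℂ) ^ s =
      Complex.exp (s * u) * (((1 + Real.exp u : ℝ) : ℂ)) ^ (-s) := by
    rw [e1, Complex.ofReal_mul, Complex.mul_cpow_ofReal_nonneg (Real.exp_pos _).le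
      (inv_pos.2 hu).le, Complex.ofReal_inv, Complex.inv_cpow _ _ (by
        rw [Complex.arg_ofReal_of_nonneg hu.le]; exact Real.pi_pos.ne), ← Complex.cpow_neg,
      Complex.cpow_def_of_ne_zero (by exact_mod_cast (Real.exp_pos u).ne'),
      ← Complex.ofReal_log (Real.exp_pos u).le, Real.log_exp, mul_comm s]
  have e4 : (((1 : ℝ) - Real.sigmoid u : ℝ) : ℂ) ^ ((p : ℂ) - s) =
      (((1 + Real.exp u : ℝ) : ℂ)) ^ (s - p) := by
    rw [e2, Complex.ofReal_inv, Complex.inv_cpow _ _ (by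
        rw [Complex.arg_ofReal_of_nonneg hu.le]; exact Real.pi_pos.ne), ← Complex.cpow_neg,
      neg_sub]
  have hs0 : ((Real.sigmoid u : ℝ) : ℂ) ≠ 0 := by exact_mod_cast (Real.sigmoid_pos u).ne'
  have hs1 : (((1 : ℝ) - Real.sigmoid u : ℝ) : ℂ) ≠ 0 := by
    exact_mod_cast (sub_pos.2 (Real.sigmoid_lt_one u)).ne'
  have hu' : ((1 + Real.exp u : ℝ) : ℂ) ≠ 0 := by exact_mod_cast hu.ne'
  beta_reduce
  rw [abs_of_pos (mul_pos (Real.sigmoid_pos u) (sub_pos.2 (Real.sigmoid_lt_one u)))]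
  simp only [Complex.real_smul]
  rw [Complex.cpow_sub _ _ hs0, Complex.cpow_one, ← Complex.ofReal_one, ← Complex.ofReal_sub,
    Complex.cpow_sub _ _ hs1, Complex.ofReal_one, Complex.cpow_one, e3, e4]
  have e5 : ((1 + Real.exp u : ℝ) : ℂ) ^ (-s) * ((1 + Real.exp u : ℝ) : ℂ) ^ (s - p) =
      (1 + Complex.exp u) ^ (-(p : ℂ)) := by
    rw [← Complex.cpow_add _ _ hu']
    push_cast
    congr 1
    ring
  rw [betaIntegrand, ← e5]
  push_cast at hs0 hs1 ⊢
  field_simp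

/-- Euler's beta integral along the ray of argument `θ`. -/
lemma integral_betaIntegrand {s : ℂ} {p θ : ℝ} (hs : 0 < s.re) (hp : s.re < p)
    (hθ : |θ| < Real.pi) :
    ∫ u : ℝ, betaIntegrand s p (u + θ * Complex.I) =
      Complex.Gamma s * Complex.Gamma (p - s) / Complex.Gamma p := by
  have hle {v : ℝ} (hv : v ∈ uIcc 0 θ) : |v| ≤ |θ| := by
    simpa using abs_sub_left_of_mem_uIcc hv
  rw [← integral_betaIntegrand_ofReal hs hp]
  exact integral_add_mul_I_eq (lt_min hs (sub_pos.2 hp))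
    (fun z hz => (differentiableAt_betaIntegrand s p
      ((hle hz).trans_lt hθ)).differentiableWithinAt)
    fun u v hv => norm_betaIntegrand_le hs hp hθ (hle hv)

/-! ### Parseval's identity -/

open scoped FourierTransform in
/-- Parseval's identity, for a pair of integrable functions of which one is continuous and has an
integrable Fourier transform. -/
lemma integral_fourier_mul_conj_fourier {f g : ℝ → ℂ} (hf : Integrable f) (hg : Integrable g)
    (hgc : Continuous g) (hG : Integrable (𝓕 g)) :
    ∫ x, 𝓕 f x * conj (𝓕 g x) = ∫ u, f u * conj (g u) := by
  have hG' : Integrable fun x => conj (𝓕 g x) :=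
    ⟨Complex.continuous_conj.comp_aestronglyMeasurable hG.1,
      by simpa [HasFiniteIntegral] using hG.2⟩
  have h1 := VectorFourier.integral_fourierIntegral_smul_eq_flip (L := innerₗ ℝ)
    (μ := volume) (ν := volume) Real.continuous_fourierChar continuous_inner hf hG'
  have h2 (u : ℝ) : VectorFourier.fourierIntegral 𝐞 volume (innerₗ ℝ).flip
      (fun x => conj (𝓕 g x)) u = conj (g u) := by
    conv_rhs => rw [← hgc.fourierInv_fourier_eq hg hG]
    rw [Real.fourierInv_eq, ← integral_conj, VectorFourier.fourierIntegral]
    refine integral_congr_ae (.of_forall fun v => ?_)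
    simp [Circle.smul_def, Real.fourierChar_apply, ← Complex.exp_conj, Complex.conj_ofNat]
  simp only [h2, smul_eq_mul] at h1
  exact h1

/-! ### The weight function -/

lemma conj_Gamma_line (a x : ℝ) :
    conj (Complex.Gamma (a + Complex.I * x)) = Complex.Gamma (a - Complex.I * x) := by
  rw [← Complex.Gamma_conj]
  simp [sub_eq_add_neg]

lemma norm_Gamma_line_neg (a x : ℝ) :
    ‖Complex.Gamma (a - Complex.I * x)‖ = ‖Complex.Gamma (a + Complex.I * x)‖ := by
  rw [← conj_Gamma_line, Complex.norm_conj]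

lemma continuous_Gamma_line {a : ℝ} (ha : 0 < a) :
    Continuous fun x : ℝ => Complex.Gamma (a + Complex.I * x) := by
  rw [continuous_iff_continuousAt]
  intro x
  refine ContinuousAt.comp (g := Complex.Gamma) ?_ (by fun_prop)
  refine (Complex.differentiableAt_Gamma _ fun m h => ?_).continuousAt
  have := congrArg Complex.re h
  simp only [Complex.add_re, Complex.ofReal_re, Complex.mul_re, Complex.I_re, zero_mul,
    Complex.I_im, Complex.ofReal_im, mul_zero, sub_zero, add_zero, Complex.neg_re,
    Complex.natCast_re] at this
  have : (0 : ℝ) ≤ m := m.cast_nonneg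
  linarith

lemma betaIntegrand_add_I_mul (a x p : ℝ) (ζ : ℂ) :
    betaIntegrand (a + Complex.I * x) p ζ =
      Complex.exp (Complex.I * x * ζ) * betaIntegrand a p ζ := by
  rw [betaIntegrand, betaIntegrand, add_mul, Complex.exp_add]
  ring

/-- Moving the line of integration in the beta integral towards the boundary `|Im ζ| = π` of the
strip gives exponential decay of products of two Gamma functions on vertical lines. -/
lemma exists_norm_Gamma_mul_Gamma_le {a b θ : ℝ} (ha : 0 < a) (hb : 0 < b) (hθ0 : 0 ≤ θ)
    (hθ : θ < Real.pi) : ∃ C, 0 ≤ C ∧ ∀ x : ℝ,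
      ‖Complex.Gamma (a + Complex.I * x) * Complex.Gamma (b - Complex.I * x)‖ ≤
        C * Real.exp (-(θ * |x|)) := by
  set δ := min a b
  set K := Real.cos (θ / 2) ^ (-(a + b))
  refine ⟨‖Complex.Gamma ((a + b : ℝ) : ℂ)‖ * ∫ u : ℝ, K * Real.exp (-(δ * |u|)), ?_, fun x => ?_⟩
  · have : 0 ≤ Real.cos (θ / 2) := Real.cos_nonneg_of_mem_Icc
      ⟨by linarith [Real.pi_pos], by linarith⟩
    exact mul_nonneg (norm_nonneg _) (integral_nonneg fun u => by positivity)
  obtain ⟨η, hη, hηx⟩ : ∃ η : ℝ, |η| = θ ∧ η * x = θ * |x| := by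
    rcases le_total 0 x with h | h
    · exact ⟨θ, abs_of_nonneg hθ0, by rw [abs_of_nonneg h]⟩
    · exact ⟨-θ, by rw [abs_neg, abs_of_nonneg hθ0], by rw [abs_of_nonpos h]; ring⟩
  have hs : 0 < ((a : ℂ) + Complex.I * x).re := by simpa
  have h1 := integral_betaIntegrand (s := a + Complex.I * x) (p := a + b) (θ := η) hs (by simpa)
    (hη ▸ hθ)
  have hΓ : Complex.Gamma ((a + b : ℝ) : ℂ) ≠ 0 := Complex.Gamma_ne_zero_of_re_pos (by
    rw [Complex.ofReal_re]; positivity)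
  rw [eq_div_iff hΓ, show ((a + b : ℝ) : ℂ) - (a + Complex.I * x) = b - Complex.I * x by
    push_cast; ring] at h1
  rw [← h1, norm_mul, mul_comm, mul_assoc]
  refine mul_le_mul_of_nonneg_left ?_ (norm_nonneg _)
  rw [← integral_mul_const]
  refine norm_integral_le_of_norm_le
    (((integrable_exp_neg_mul_abs (lt_min ha hb)).const_mul K).mul_const _)
    (.of_forall fun u => ?_)
  have h2 := norm_betaIntegrand_le (s := a) (p := a + b) (θ := η) (u := u) (v := η) (by simpa)
    (by simpa) (hη ▸ hθ) le_rfl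
  have h3 : Real.cos (η / 2) = Real.cos (θ / 2) := by
    rw [← Real.cos_abs (η / 2), abs_div, hη, abs_two]
  simp only [Complex.ofReal_im, abs_zero, zero_mul, Real.exp_zero, one_mul, Complex.ofReal_re,
    add_sub_cancel_left, h3] at h2
  rw [betaIntegrand_add_I_mul, norm_mul, Complex.norm_exp, mul_comm]
  refine mul_le_mul h2 (le_of_eq ?_) (Real.exp_pos _).le ((norm_nonneg _).trans h2)
  congr 1
  simp only [Complex.mul_re, Complex.I_re, Complex.ofReal_re, zero_mul, Complex.I_im,
    Complex.ofReal_im, mul_zero, sub_zero, Complex.mul_im, one_mul, zero_add, Complex.add_re,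
    Complex.add_im, mul_one, add_zero, zero_sub]
  linarith

lemma continuous_rotated_betaIntegrand (a p : ℝ) :
    Continuous fun u : ℝ => betaIntegrand a p (u + (Real.pi / 2 : ℝ) * Complex.I) := by
  rw [continuous_iff_continuousAt]
  intro u
  refine ContinuousAt.comp (g := betaIntegrand a p)
    (differentiableAt_betaIntegrand _ _ ?_).continuousAt (by fun_prop)
  simp only [Complex.add_im, Complex.ofReal_im, Complex.mul_im, Complex.ofReal_re, Complex.I_im,
    mul_one, Complex.I_re, mul_zero, add_zero, zero_add]
  rw [abs_of_pos Real.pi_div_two_pos]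
  linarith [Real.pi_pos]

lemma exists_norm_rotated_betaIntegrand_le {a p : ℝ} (ha : 0 < a) (hp : a < p) :
    ∃ C, ∀ u : ℝ, ‖betaIntegrand a p (u + (Real.pi / 2 : ℝ) * Complex.I)‖ ≤
      C * Real.exp (-(min a (p - a) * |u|)) :=
  ⟨_, fun u => by
    simpa using norm_betaIntegrand_le (s := a) (p := p) (θ := Real.pi / 2) (u := u)
      (v := Real.pi / 2) (by simpa) (by simpa)
      (by rw [abs_of_pos Real.pi_div_two_pos]; linarith [Real.pi_pos]) le_rfl⟩

lemma integrable_rotated_betaIntegrand {a p : ℝ} (ha : 0 < a) (hp : a < p) :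
    Integrable fun u : ℝ => betaIntegrand a p (u + (Real.pi / 2 : ℝ) * Complex.I) := by
  obtain ⟨C, hC⟩ := exists_norm_rotated_betaIntegrand_le ha hp
  exact ((integrable_exp_neg_mul_abs (lt_min ha (sub_pos.2 hp))).const_mul C).mono'
    (continuous_rotated_betaIntegrand a p).aestronglyMeasurable (.of_forall hC)

open scoped FourierTransform in
lemma fourier_rotated_betaIntegrand {a p : ℝ} (ha : 0 < a) (hp : a < p) (x : ℝ) :
    𝓕 (fun u : ℝ => betaIntegrand a p (u + (Real.pi / 2 : ℝ) * Complex.I))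
        (-(2 * Real.pi)⁻¹ * x) =
      Complex.exp ((Real.pi / 2 * x : ℝ)) * (Complex.Gamma (a + Complex.I * x) *
        Complex.Gamma ((p - a : ℝ) - Complex.I * x)) / Complex.Gamma p := by
  have h := integral_betaIntegrand (s := a + Complex.I * x) (p := p) (θ := Real.pi / 2)
    (by simpa) (by simpa) (by rw [abs_of_pos Real.pi_div_two_pos]; linarith [Real.pi_pos])
  rw [show (p : ℂ) - (a + Complex.I * x) = (p - a : ℝ) - Complex.I * x by push_cast; ring] at h
  rw [mul_div_assoc, ← h, ← integral_const_mul, Real.fourier_real_eq_integral_exp_smul]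
  refine integral_congr_ae (.of_forall fun u => ?_)
  beta_reduce
  rw [betaIntegrand_add_I_mul, ← mul_assoc (Complex.exp _), ← Complex.exp_add, smul_eq_mul]
  congr 2
  have hpi : (Real.pi : ℂ) ≠ 0 := Complex.ofReal_ne_zero.2 Real.pi_ne_zero
  push_cast
  field_simp
  ring_nf
  simp only [Complex.I_sq]
  ring

/-- Since the exponents differ by one, the product is a positive function times the conjugate of
`1 + exp (u + iπ/2) = 1 + i exp u`. -/
lemma rotated_betaIntegrand_mul_conj (a p u : ℝ) :
    betaIntegrand a (p + 1) (u + (Real.pi / 2 : ℝ) * Complex.I) *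
        conj (betaIntegrand a p (u + (Real.pi / 2 : ℝ) * Complex.I)) =
      ((Real.exp (2 * a * u) * (1 + Real.exp (2 * u)) ^ (-(p + 1)) : ℝ) : ℂ) *
        (1 - Complex.I * Real.exp u) := by
  have hexp : Complex.exp (u + (Real.pi / 2 : ℝ) * Complex.I) = Complex.I * Real.exp u := by
    rw [Complex.exp_add]
    push_cast
    rw [Complex.exp_pi_div_two_mul_I]
    ring
  obtain ⟨w, hw⟩ : ∃ w : ℂ, 1 + Complex.I * Real.exp u = w := ⟨_, rfl⟩
  have hw0 : w ≠ 0 := fun h => by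
    simpa [← hw, -Complex.ofReal_exp] using congrArg Complex.re h
  have hwn : ‖w‖ ^ 2 = 1 + Real.exp (2 * u) := by
    rw [← Complex.normSq_eq_norm_sq, Complex.normSq_apply, two_mul u, Real.exp_add]
    simp [← hw, -Complex.ofReal_exp]
  have hwinv : w⁻¹ = (1 - Complex.I * Real.exp u) * ((‖w‖ ^ 2)⁻¹ : ℝ) := by
    rw [Complex.inv_def, Complex.normSq_eq_norm_sq]
    congr 1
    simp [← hw, sub_eq_add_neg, -Complex.ofReal_exp]
  have h1 : w ^ (-((p + 1 : ℝ) : ℂ)) = w ^ (-(p : ℂ)) * w⁻¹ := by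
    rw [← Complex.cpow_neg_one, ← Complex.cpow_add _ _ hw0]
    congr 1
    push_cast
    ring
  have h2 : w ^ (-(p : ℂ)) * conj (w ^ (-(p : ℂ))) = (((‖w‖ ^ 2) ^ (-p) : ℝ) : ℂ) := by
    rw [Complex.mul_conj, Complex.normSq_eq_norm_sq, ← Complex.ofReal_neg, Complex.norm_cpow_real,
      ← Real.rpow_natCast, ← Real.rpow_natCast, ← Real.rpow_mul (norm_nonneg _),
      ← Real.rpow_mul (norm_nonneg _), mul_comm]
  have h3 (z : ℂ) : Complex.exp (a * z) * conj (Complex.exp (a * z)) =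
      ((Real.exp (2 * a * z.re) : ℝ) : ℂ) := by
    rw [Complex.mul_conj, Complex.normSq_eq_norm_sq, Complex.norm_exp, ← Real.exp_nat_mul]
    congr 2
    simp
    ring
  have h4 := h3 (u + (Real.pi / 2 : ℝ) * Complex.I)
  have h5 : ((u : ℂ) + (Real.pi / 2 : ℝ) * Complex.I).re = u := by simp
  rw [h5] at h4
  have h6 : (1 + Real.exp (2 * u)) ^ (-(p + 1)) =
      (‖w‖ ^ 2) ^ (-p) * (‖w‖ ^ 2)⁻¹ := by
    rw [← hwn, ← Real.rpow_neg_one, ← Real.rpow_add (by positivity)]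
    congr 1
    ring
  rw [betaIntegrand, betaIntegrand, hexp, hw, map_mul, h1, hwinv, h6]
  push_cast at h2 h4 ⊢
  linear_combination (w ^ (-(p : ℂ)) * conj (w ^ (-(p : ℂ)))) *
    ((1 - Complex.I * Complex.exp u) * ((‖w‖ : ℂ) ^ 2)⁻¹) * h4 +
    Complex.exp (2 * a * u) * ((1 - Complex.I * Complex.exp u) * ((‖w‖ : ℂ) ^ 2)⁻¹) * h2

lemma integral_exp_mul_one_add_exp_two_mul {a b : ℝ} (ha : 0 < a) (hb : 0 < b) :
    ∫ u : ℝ, Real.exp (2 * a * u) * (1 + Real.exp (2 * u)) ^ (-(a + b + 1)) * Real.exp u =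
      Real.Gamma (a + 1 / 2) * Real.Gamma (b + 1 / 2) / Real.Gamma (a + b + 1) / 2 := by
  have h := integral_betaIntegrand_ofReal (s := (a + 1 / 2 : ℝ)) (p := a + b + 1)
    (by rw [Complex.ofReal_re]; positivity) (by rw [Complex.ofReal_re]; linarith)
  have h1 (u : ℝ) : betaIntegrand (a + 1 / 2 : ℝ) (a + b + 1) u =
      ((Real.exp ((a + 1 / 2) * u) * (1 + Real.exp u) ^ (-(a + b + 1)) : ℝ) : ℂ) := by
    rw [betaIntegrand, Complex.ofReal_mul, Complex.ofReal_cpow (by positivity)]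
    push_cast
    rfl
  simp_rw [h1] at h
  rw [integral_complex_ofReal, ← Complex.ofReal_sub, Complex.Gamma_ofReal, Complex.Gamma_ofReal,
    Complex.Gamma_ofReal, ← Complex.ofReal_mul, ← Complex.ofReal_div, Complex.ofReal_inj,
    show a + b + 1 - (a + 1 / 2) = b + 1 / 2 by ring] at h
  rw [← h]
  have h2 := Measure.integral_comp_mul_left
    (fun u => Real.exp ((a + 1 / 2) * u) * (1 + Real.exp u) ^ (-(a + b + 1))) 2
  rw [abs_of_pos (by norm_num), smul_eq_mul, inv_mul_eq_div] at h2
  rw [← h2]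
  refine integral_congr_ae (.of_forall fun u => ?_)
  beta_reduce
  rw [mul_right_comm, ← Real.exp_add]
  congr 2
  ring

lemma integrable_of_norm_le_exp_neg_mul_abs {C κ : ℝ} (hκ : 0 < κ) {f : ℝ → ℂ} (hf : Continuous f)
    (h : ∀ x, ‖f x‖ ≤ C * Real.exp (-(κ * |x|))) : Integrable f :=
  ((integrable_exp_neg_mul_abs hκ).const_mul C).mono' hf.aestronglyMeasurable (.of_forall h)

open scoped FourierTransform in
lemma integrable_fourier_rotated_betaIntegrand {a p : ℝ} (ha : 0 < a) (hp : a < p) :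
    Integrable (𝓕 (fun u : ℝ => betaIntegrand a p (u + (Real.pi / 2 : ℝ) * Complex.I))) := by
  have hne : -(2 * Real.pi)⁻¹ ≠ 0 := neg_ne_zero.2 (inv_ne_zero (by positivity))
  rw [← integrable_comp_mul_left_iff _ hne]
  simp_rw [fourier_rotated_betaIntegrand ha hp]
  refine Integrable.div_const ?_ _
  obtain ⟨C, hC0, hC⟩ := exists_norm_Gamma_mul_Gamma_le ha (sub_pos.2 hp)
    (θ := 3 * Real.pi / 4) (by positivity) (by linarith [Real.pi_pos])
  have hcont : Continuous fun x : ℝ => Complex.Gamma ((p - a : ℝ) - Complex.I * x) := by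
    simp_rw [← conj_Gamma_line]
    exact Complex.continuous_conj.comp (continuous_Gamma_line (sub_pos.2 hp))
  refine integrable_of_norm_le_exp_neg_mul_abs (C := C) (κ := Real.pi / 4) (by positivity)
    (.mul (by fun_prop) ((continuous_Gamma_line ha).mul hcont)) fun x => ?_
  rw [norm_mul, Complex.norm_exp, Complex.ofReal_re, mul_comm]
  refine (mul_le_mul_of_nonneg_right (hC x) (Real.exp_pos _).le).trans ?_
  rw [mul_assoc, ← Real.exp_add]
  refine mul_le_mul_of_nonneg_left (Real.exp_le_exp.2 ?_) hC0
  nlinarith [le_abs_self x, Real.pi_pos]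

open scoped FourierTransform in
/-- The real line version of the weight integral: the factor `-x` is the imaginary part of
`b - ix`, the quotient of `Γ(b + 1 - ix)` by `Γ(b - ix)`, so that Parseval's identity applies. -/
lemma integrable_and_integral_mul_exp_mul_norm_Gamma {a b : ℝ} (ha : 0 < a) (hb : 0 < b) :
    Integrable (fun x : ℝ => x * Real.exp (Real.pi * x) *
        (‖Complex.Gamma (a + Complex.I * x)‖ ^ 2 * ‖Complex.Gamma (b + Complex.I * x)‖ ^ 2)) ∧
      ∫ x : ℝ, x * Real.exp (Real.pi * x) *
        (‖Complex.Gamma (a + Complex.I * x)‖ ^ 2 * ‖Complex.Gamma (b + Complex.I * x)‖ ^ 2) =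
      Real.pi * Real.Gamma (a + b) * Real.Gamma (a + 1 / 2) * Real.Gamma (b + 1 / 2) := by
  have hp1 : a < a + b := by linarith
  have hp2 : a < a + b + 1 := by linarith
  set f : ℝ → ℂ := fun u => betaIntegrand a (a + b + 1) (u + (Real.pi / 2 : ℝ) * Complex.I)
    with hf
  set g : ℝ → ℂ := fun u => betaIntegrand a (a + b) (u + (Real.pi / 2 : ℝ) * Complex.I) with hg
  have hfi : Integrable f := integrable_rotated_betaIntegrand ha hp2
  have hgi : Integrable g := integrable_rotated_betaIntegrand ha hp1
  have hGi : Integrable (𝓕 g) := integrable_fourier_rotated_betaIntegrand ha hp1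
  have hpars := integral_fourier_mul_conj_fourier hfi hgi (continuous_rotated_betaIntegrand a _) hGi
  have hne : -(2 * Real.pi)⁻¹ ≠ 0 := neg_ne_zero.2 (inv_ne_zero (by positivity))
  have hprod : Integrable fun y => 𝓕 f y * conj (𝓕 g y) := by
    have hcF : Continuous (𝓕 f) := VectorFourier.fourierIntegral_continuous
      Real.continuous_fourierChar continuous_inner hfi
    refine Integrable.bdd_mul (c := ∫ u, ‖f u‖) ?_ hcF.aestronglyMeasurable
      (.of_forall fun y => VectorFourier.norm_fourierIntegral_le_integral_norm _ _ _ _ _)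
    exact ⟨Complex.continuous_conj.comp_aestronglyMeasurable hGi.1,
      by simpa [HasFiniteIntegral] using hGi.2⟩
  have hΓ1 : 0 < Real.Gamma (a + b) := Real.Gamma_pos_of_pos (by positivity)
  have hΓ2 : 0 < Real.Gamma (a + b + 1) := Real.Gamma_pos_of_pos (by positivity)
  have hval (x : ℝ) : 𝓕 f (-(2 * Real.pi)⁻¹ * x) * conj (𝓕 g (-(2 * Real.pi)⁻¹ * x)) =
      ((Real.exp (Real.pi * x) * (‖Complex.Gamma (a + Complex.I * x)‖ ^ 2 *
        ‖Complex.Gamma (b + Complex.I * x)‖ ^ 2) /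
          (Real.Gamma (a + b) * Real.Gamma (a + b + 1)) : ℝ) : ℂ) * (b - Complex.I * x) := by
    have hb' : (b : ℂ) - Complex.I * x ≠ 0 := fun h => hb.ne' (by
      simpa using congrArg Complex.re h)
    rw [hf, hg, fourier_rotated_betaIntegrand ha hp1, fourier_rotated_betaIntegrand ha hp2,
      show ((a + b + 1 - a : ℝ) : ℂ) - Complex.I * x = (b - Complex.I * x) + 1 by push_cast; ring,
      Complex.Gamma_add_one _ hb', add_sub_cancel_left, Complex.Gamma_ofReal,
      Complex.Gamma_ofReal]
    have e1 : (Real.exp (Real.pi * x) : ℂ) =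
        Complex.exp ((Real.pi / 2 * x : ℝ)) * conj (Complex.exp ((Real.pi / 2 * x : ℝ))) := by
      rw [← Complex.exp_conj, Complex.conj_ofReal, ← Complex.exp_add]
      push_cast
      ring_nf
    have e2 : ((‖Complex.Gamma (a + Complex.I * x)‖ : ℂ)) ^ 2 =
        Complex.Gamma (a + Complex.I * x) * conj (Complex.Gamma (a + Complex.I * x)) :=
      (Complex.mul_conj' _).symm
    have e3 : ((‖Complex.Gamma (b + Complex.I * x)‖ : ℂ)) ^ 2 =
        Complex.Gamma (b - Complex.I * x) * conj (Complex.Gamma (b - Complex.I * x)) := by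
      rw [← norm_Gamma_line_neg]
      exact (Complex.mul_conj' _).symm
    rw [Complex.ofReal_div, Complex.ofReal_mul, Complex.ofReal_mul, Complex.ofReal_mul,
      Complex.ofReal_pow, Complex.ofReal_pow, e1, e2, e3, map_div₀, map_mul, map_mul,
      Complex.conj_ofReal]
    push_cast
    generalize Complex.exp (Real.pi / 2 * x) = E
    generalize Complex.Gamma (a + Complex.I * x) = A
    generalize Complex.Gamma (b - Complex.I * x) = B
    have hΓ1' : (Real.Gamma (a + b) : ℂ) ≠ 0 := Complex.ofReal_ne_zero.2 hΓ1.ne'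
    have hΓ2' : (Real.Gamma (a + b + 1) : ℂ) ≠ 0 := Complex.ofReal_ne_zero.2 hΓ2.ne'
    field_simp
  have hx (x : ℝ) : x * Real.exp (Real.pi * x) * (‖Complex.Gamma (a + Complex.I * x)‖ ^ 2 *
      ‖Complex.Gamma (b + Complex.I * x)‖ ^ 2) =
      -(Real.Gamma (a + b) * Real.Gamma (a + b + 1)) *
        (𝓕 f (-(2 * Real.pi)⁻¹ * x) * conj (𝓕 g (-(2 * Real.pi)⁻¹ * x))).im := by
    rw [hval, Complex.im_ofReal_mul]
    simp only [Complex.sub_im, Complex.ofReal_im, Complex.mul_im, Complex.I_re, Complex.I_im,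
      Complex.ofReal_re, zero_mul, one_mul, zero_add, zero_sub]
    field_simp
  have hcomp := (integrable_comp_mul_left_iff _ hne).2 hprod
  simp_rw [hx]
  refine ⟨hcomp.im.const_mul _, ?_⟩
  have hgb : Integrable fun u => f u * conj (g u) := by
    obtain ⟨C, hC⟩ := exists_norm_rotated_betaIntegrand_le ha hp1
    have hC' (u : ℝ) : ‖conj (g u)‖ ≤ |C| := by
      rw [Complex.norm_conj]
      refine (hC u).trans ((mul_le_mul_of_nonneg_right (le_abs_self C) (Real.exp_pos _).le).trans ?_)
      refine mul_le_of_le_one_right (abs_nonneg C) (Real.exp_le_one_iff.2 ?_)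
      have : 0 < min a (a + b - a) := lt_min ha (by linarith)
      have := abs_nonneg u
      nlinarith
    exact hfi.mul_bdd (c := |C|) (Complex.continuous_conj.comp
      (continuous_rotated_betaIntegrand a _)).aestronglyMeasurable (.of_forall hC')
  have him := integral_im hcomp
  have him' := integral_im hgb
  simp only [RCLike.im_eq_complex_im] at him him'
  have h2 := Measure.integral_comp_mul_left (fun y => 𝓕 f y * conj (𝓕 g y)) (-(2 * Real.pi)⁻¹)
  have h3 : ∫ u, (f u * conj (g u)).im =
      -(Real.Gamma (a + 1 / 2) * Real.Gamma (b + 1 / 2) / Real.Gamma (a + b + 1) / 2) := by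
    rw [← integral_exp_mul_one_add_exp_two_mul ha hb, ← integral_neg]
    refine integral_congr_ae (.of_forall fun u => ?_)
    beta_reduce
    rw [hf, hg]
    beta_reduce
    rw [rotated_betaIntegrand_mul_conj, Complex.im_ofReal_mul]
    simp [-Complex.ofReal_exp]
  rw [integral_const_mul, him, h2, hpars, Complex.smul_im, ← him', h3, inv_neg, inv_inv, abs_neg,
    abs_of_pos (by positivity), smul_eq_mul]
  field_simp

lemma norm_Gamma_I_mul_sq {x : ℝ} (hx : 0 < x) :
    ‖Complex.Gamma (Complex.I * x)‖ ^ 2 = Real.pi / (x * Real.sinh (Real.pi * x)) := by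
  have h1 := Complex.Gamma_mul_Gamma_one_sub (Complex.I * x)
  have hx' : -(Complex.I * x) ≠ 0 :=
    neg_ne_zero.2 (mul_ne_zero Complex.I_ne_zero (Complex.ofReal_ne_zero.2 hx.ne'))
  have h2 : conj (Complex.Gamma (Complex.I * x)) = Complex.Gamma (-(Complex.I * x)) := by
    rw [← Complex.Gamma_conj]
    simp
  rw [sub_eq_neg_add, Complex.Gamma_add_one _ hx', ← h2,
    show (Real.pi : ℂ) * (Complex.I * x) = (Real.pi * x : ℝ) * Complex.I by push_cast; ring,
    Complex.sin_mul_I, ← Complex.ofReal_sinh] at h1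
  have hs : 0 < Real.sinh (Real.pi * x) := Real.sinh_pos_iff.2 (by positivity)
  have hs' : (Real.sinh (Real.pi * x) : ℂ) ≠ 0 := Complex.ofReal_ne_zero.2 hs.ne'
  have hx'' : (x : ℂ) ≠ 0 := Complex.ofReal_ne_zero.2 hx.ne'
  rw [← Complex.ofReal_inj, Complex.ofReal_pow, ← Complex.mul_conj', Complex.ofReal_div,
    Complex.ofReal_mul, eq_div_iff (mul_ne_zero hx'' hs')]
  rw [eq_div_iff (mul_ne_zero hs' Complex.I_ne_zero)] at h1
  linear_combination h1 + x * Complex.Gamma (Complex.I * x) *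
    conj (Complex.Gamma (Complex.I * x)) * Real.sinh (Real.pi * x) * Complex.I_sq

/-- The continuous dual Hahn weight for the parameters `a`, `b`, `1/2`: the de Branges–Wilson
integral in the case where the third factor reduces, by duplication, to `Γ(ix)⁻¹`. -/
lemma integrableOn_and_integral_weight {a b : ℝ} (ha : 0 < a) (hb : 0 < b) :
    Integrable (fun x : ℝ => ‖Complex.Gamma (a + Complex.I * x)‖ ^ 2 *
        ‖Complex.Gamma (b + Complex.I * x)‖ ^ 2 / ‖Complex.Gamma (Complex.I * x)‖ ^ 2) halfLine ∧
      ∫ x : ℝ, ‖Complex.Gamma (a + Complex.I * x)‖ ^ 2 *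
        ‖Complex.Gamma (b + Complex.I * x)‖ ^ 2 / ‖Complex.Gamma (Complex.I * x)‖ ^ 2 ∂halfLine =
      Real.Gamma (a + b) * Real.Gamma (a + 1 / 2) * Real.Gamma (b + 1 / 2) / 2 := by
  obtain ⟨h1, h2⟩ := integrable_and_integral_mul_exp_mul_norm_Gamma ha hb
  set h : ℝ → ℝ := fun x => x * Real.exp (Real.pi * x) *
    (‖Complex.Gamma (a + Complex.I * x)‖ ^ 2 * ‖Complex.Gamma (b + Complex.I * x)‖ ^ 2) with hh
  have h3 : Integrable (fun x => h (-x)) := h1.comp_neg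
  have heq : ∀ x ∈ Ioi (0 : ℝ), (h x + h (-x)) / (2 * Real.pi) =
      ‖Complex.Gamma (a + Complex.I * x)‖ ^ 2 *
        ‖Complex.Gamma (b + Complex.I * x)‖ ^ 2 / ‖Complex.Gamma (Complex.I * x)‖ ^ 2 := by
    intro x hx
    have hx0 : (0 : ℝ) < x := hx
    have hs : 0 < Real.sinh (Real.pi * x) := Real.sinh_pos_iff.2 (by positivity)
    rw [norm_Gamma_I_mul_sq hx0, hh]
    simp only [Complex.ofReal_neg, mul_neg, ← sub_eq_add_neg, norm_Gamma_line_neg]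
    rw [Real.sinh_eq] at hs ⊢
    field_simp
    ring
  have h4 : IntegrableOn (fun x => (h x + h (-x)) / (2 * Real.pi)) (Ioi 0) :=
    ((h1.add h3).div_const _).integrableOn
  refine ⟨h4.congr_fun heq measurableSet_Ioi, ?_⟩
  rw [← setIntegral_congr_fun measurableSet_Ioi heq, integral_div,
    integral_add h1.integrableOn h3.integrableOn]
  have h5 := integral_comp_neg_Ioi 0 h
  rw [neg_zero] at h5
  rw [h5, add_comm, ← setIntegral_union (Iic_disjoint_Ioi le_rfl) measurableSet_Ioi h1.integrableOn
    h1.integrableOn, Iic_union_Ioi, setIntegral_univ, h2]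
  field_simp

/-! ### Orthogonality of the continuous dual Hahn polynomials -/

/-- The weight `|Γ(a + iξ)² / Γ(iξ)|²` of the continuous dual Hahn polynomials with parameters
`a`, `a`, `1/2`. -/
noncomputable def dualHahnWeight (a ξ : ℝ) : ℝ :=
  ‖Complex.Gamma (a + Complex.I * ξ)‖ ^ 4 / ‖Complex.Gamma (Complex.I * ξ)‖ ^ 2

lemma Gamma_add_nat {s : ℂ} (hs : 0 < s.re) (n : ℕ) :
    Complex.Gamma (s + n) = poch s n * Complex.Gamma s := by
  induction n with
  | zero => simp
  | succ n ih =>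
    have : s + n ≠ 0 := fun h => by
      have := congrArg Complex.re h
      simp only [Complex.add_re, Complex.natCast_re, Complex.zero_re] at this
      have : (0 : ℝ) ≤ n := n.cast_nonneg
      linarith
    rw [Nat.cast_add, Nat.cast_one, ← add_assoc, Complex.Gamma_add_one _ this, ih, poch_succ]
    ring

lemma ofReal_Gamma_add_nat {a : ℝ} (ha : 0 < a) (n : ℕ) :
    (Real.Gamma (a + n) : ℂ) = poch a n * Real.Gamma a := by
  rw [← Complex.Gamma_ofReal, ← Complex.Gamma_ofReal, Complex.ofReal_add, Complex.ofReal_natCast,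
    Gamma_add_nat (by simpa)]

lemma poch_mul_poch_conj (a ξ : ℝ) (j : ℕ) :
    poch (a + Complex.I * ξ) j * poch (a - Complex.I * ξ) j =
      ((‖poch (a + Complex.I * ξ) j‖ ^ 2 : ℝ) : ℂ) := by
  rw [Complex.ofReal_pow, ← Complex.mul_conj', conj_poch]
  simp [sub_eq_add_neg]

/-- The products `(a ± iξ)_j` and `(a ± iξ)_l` are absorbed into the Gamma functions of the weight
by raising the parameters to `a + j` and `a + l`. -/
lemma integrable_and_integral_weight_mul_poch {a : ℝ} (ha : 0 < a) (j l : ℕ) :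
    Integrable (fun ξ : ℝ => (dualHahnWeight a ξ : ℂ) *
      ((poch (a + Complex.I * ξ) j * poch (a - Complex.I * ξ) j) *
        (poch (a + Complex.I * ξ) l * poch (a - Complex.I * ξ) l))) halfLine ∧
    ∫ ξ : ℝ, (dualHahnWeight a ξ : ℂ) *
      ((poch (a + Complex.I * ξ) j * poch (a - Complex.I * ξ) j) *
        (poch (a + Complex.I * ξ) l * poch (a - Complex.I * ξ) l)) ∂halfLine =
      ((Real.Gamma (a + j + (a + l)) * Real.Gamma (a + j + 1 / 2) *
        Real.Gamma (a + l + 1 / 2) / 2 : ℝ) : ℂ) := by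
  have hj : 0 < a + j := by positivity
  have hl : 0 < a + l := by positivity
  obtain ⟨h1, h2⟩ := integrableOn_and_integral_weight hj hl
  have h3 (m : ℕ) (ξ : ℝ) : ‖Complex.Gamma ((a + m : ℝ) + Complex.I * ξ)‖ ^ 2 =
      ‖poch (a + Complex.I * ξ) m‖ ^ 2 * ‖Complex.Gamma (a + Complex.I * ξ)‖ ^ 2 := by
    rw [← mul_pow, ← norm_mul, ← Gamma_add_nat (by simpa)]
    push_cast
    ring_nf
  have h4 (ξ : ℝ) : (dualHahnWeight a ξ : ℂ) *
      ((poch (a + Complex.I * ξ) j * poch (a - Complex.I * ξ) j) *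
        (poch (a + Complex.I * ξ) l * poch (a - Complex.I * ξ) l)) =
      ((‖Complex.Gamma ((a + j : ℝ) + Complex.I * ξ)‖ ^ 2 *
        ‖Complex.Gamma ((a + l : ℝ) + Complex.I * ξ)‖ ^ 2 /
          ‖Complex.Gamma (Complex.I * ξ)‖ ^ 2 : ℝ) : ℂ) := by
    rw [h3, h3, poch_mul_poch_conj, poch_mul_poch_conj, dualHahnWeight]
    push_cast
    ring
  simp_rw [h4]
  exact ⟨h1.ofReal, by rw [integral_complex_ofReal, h2]⟩

lemma dualHahn_half_eq_sum (n : ℕ) (ξ : ℝ) {a : ℝ} (ha : 0 < a) :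
    dualHahn n ξ a a (1 / 2) = ∑ p ∈ Finset.HasAntidiagonal.antidiagonal n,
      (-1) ^ p.1 * (n.choose p.1 : ℂ) *
        (poch (2 * a + p.1) p.2 * poch ((a + 1 / 2 : ℝ) + p.1) p.2) *
        (poch (a + Complex.I * ξ) p.1 * poch (a - Complex.I * ξ) p.1) := by
  rw [dualHahn_eq_sum n ξ (by positivity) (by positivity)]
  push_cast
  simp_rw [two_mul]

lemma integrable_weight_mul_dualHahn_mul_poch {a : ℝ} (ha : 0 < a) (n k : ℕ) :
    Integrable (fun ξ : ℝ => (dualHahnWeight a ξ : ℂ) * (dualHahn n ξ a a (1 / 2) *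
      (poch (a + Complex.I * ξ) k * poch (a - Complex.I * ξ) k))) halfLine := by
  simp_rw [dualHahn_half_eq_sum n _ ha, Finset.sum_mul, Finset.mul_sum]
  refine integrable_finsetSum _ fun p _ => ?_
  refine ((integrable_and_integral_weight_mul_poch ha p.1 k).1.const_mul ((-1) ^ p.1 *
    (n.choose p.1 : ℂ) * (poch (2 * a + p.1) p.2 * poch ((a + 1 / 2 : ℝ) + p.1) p.2))).congr
    (.of_forall fun ξ => ?_)
  ring

/-- The value vanishes for `k < n` because of the factor `(-k)_n`. -/
lemma integral_weight_mul_dualHahn_mul_poch {a : ℝ} (ha : 0 < a) (n k : ℕ) :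
    ∫ ξ : ℝ, (dualHahnWeight a ξ : ℂ) * (dualHahn n ξ a a (1 / 2) *
      (poch (a + Complex.I * ξ) k * poch (a - Complex.I * ξ) k)) ∂halfLine =
      (Real.Gamma (a + 1 / 2 + n) * Real.Gamma (a + 1 / 2 + k) * Real.Gamma (2 * a + k) / 2 : ℝ) *
        poch (-(k : ℂ)) n := by
  have hterm (ξ : ℝ) : (dualHahnWeight a ξ : ℂ) * (dualHahn n ξ a a (1 / 2) *
      (poch (a + Complex.I * ξ) k * poch (a - Complex.I * ξ) k)) =
      ∑ p ∈ Finset.HasAntidiagonal.antidiagonal n, (-1) ^ p.1 * (n.choose p.1 : ℂ) *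
        (poch (2 * a + p.1) p.2 * poch ((a + 1 / 2 : ℝ) + p.1) p.2) *
        ((dualHahnWeight a ξ : ℂ) * ((poch (a + Complex.I * ξ) p.1 *
          poch (a - Complex.I * ξ) p.1) *
            (poch (a + Complex.I * ξ) k * poch (a - Complex.I * ξ) k))) := by
    rw [dualHahn_half_eq_sum n _ ha, Finset.sum_mul, Finset.mul_sum]
    exact Finset.sum_congr rfl fun p _ => by ring
  simp_rw [hterm]
  rw [integral_finsetSum _ fun p _ =>
    (integrable_and_integral_weight_mul_poch ha p.1 k).1.const_mul _]
  simp_rw [integral_const_mul, (integrable_and_integral_weight_mul_poch ha _ k).2]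
  rw [show -(k : ℂ) = 2 * a - (2 * a + k) by ring, ← sum_neg_one_pow_choose_poch, Finset.mul_sum]
  refine Finset.sum_congr rfl fun p hp => ?_
  obtain rfl : p.1 + p.2 = n := Finset.HasAntidiagonal.mem_antidiagonal.1 hp
  have e1 : (Real.Gamma (a + p.1 + (a + k)) : ℂ) =
      poch (2 * a + k) p.1 * Real.Gamma (2 * a + k) := by
    have := ofReal_Gamma_add_nat (a := 2 * a + k) (by positivity) p.1
    push_cast at this
    rw [← this]
    congr 2
    ring
  have e2 : (Real.Gamma (a + 1 / 2 + (p.1 + p.2 : ℕ)) : ℂ) =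
      poch ((a + 1 / 2 : ℝ) + p.1) p.2 * Real.Gamma (a + p.1 + 1 / 2) := by
    have := ofReal_Gamma_add_nat (a := a + 1 / 2 + p.1) (by positivity) p.2
    rw [Complex.ofReal_add (a + 1 / 2), Complex.ofReal_natCast] at this
    rw [show a + p.1 + 1 / 2 = a + 1 / 2 + p.1 by ring, ← this]
    push_cast
    ring_nf
  rw [show a + k + 1 / 2 = a + 1 / 2 + k by ring]
  simp only [Complex.ofReal_mul, Complex.ofReal_div]
  rw [e1, e2]
  ring

lemma integrable_weight_mul_dualHahn_mul_dualHahn {a : ℝ} (ha : 0 < a) (n m : ℕ) :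
    Integrable (fun ξ : ℝ => (dualHahnWeight a ξ : ℂ) *
      (dualHahn n ξ a a (1 / 2) * dualHahn m ξ a a (1 / 2))) halfLine := by
  simp_rw [dualHahn_half_eq_sum m _ ha, Finset.mul_sum]
  refine integrable_finsetSum _ fun p _ => ?_
  refine ((integrable_weight_mul_dualHahn_mul_poch ha n p.1).const_mul ((-1) ^ p.1 *
    (m.choose p.1 : ℂ) * (poch (2 * a + p.1) p.2 * poch ((a + 1 / 2 : ℝ) + p.1) p.2))).congr
    (.of_forall fun ξ => ?_)
  ring

/-- The orthogonality relation of the continuous dual Hahn polynomials. -/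
lemma integral_weight_mul_dualHahn_mul_dualHahn {a : ℝ} (ha : 0 < a) (n m : ℕ) :
    ∫ ξ : ℝ, (dualHahnWeight a ξ : ℂ) *
      (dualHahn n ξ a a (1 / 2) * dualHahn m ξ a a (1 / 2)) ∂halfLine =
      if n = m then ((Real.Gamma (a + 1 / 2 + n) ^ 2 * Real.Gamma (2 * a + n) * n.factorial / 2 : ℝ)
        : ℂ) else 0 := by
  wlog hmn : m ≤ n generalizing n m
  · have h := this m n (by omega)
    rw [if_neg (by omega)] at h ⊢
    rw [← h]
    exact integral_congr_ae (.of_forall fun ξ => by ring)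
  have hterm (ξ : ℝ) : (dualHahnWeight a ξ : ℂ) *
      (dualHahn n ξ a a (1 / 2) * dualHahn m ξ a a (1 / 2)) =
      ∑ p ∈ Finset.HasAntidiagonal.antidiagonal m, (-1) ^ p.1 * (m.choose p.1 : ℂ) *
        (poch (2 * a + p.1) p.2 * poch ((a + 1 / 2 : ℝ) + p.1) p.2) *
        ((dualHahnWeight a ξ : ℂ) * (dualHahn n ξ a a (1 / 2) *
            (poch (a + Complex.I * ξ) p.1 * poch (a - Complex.I * ξ) p.1))) := by
    rw [dualHahn_half_eq_sum m _ ha, Finset.mul_sum, Finset.mul_sum]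
    exact Finset.sum_congr rfl fun p _ => by ring
  simp_rw [hterm]
  rw [integral_finsetSum _ fun p _ =>
    (integrable_weight_mul_dualHahn_mul_poch ha n p.1).const_mul _]
  simp_rw [integral_const_mul, integral_weight_mul_dualHahn_mul_poch ha]
  rw [Finset.sum_eq_single (m, 0)]
  · split_ifs with h
    · subst h
      have hsq : ((-1 : ℂ) ^ n) * (-1) ^ n = 1 := by
        rw [← mul_pow]; simp
      rw [poch_neg_self]
      push_cast
      simp only [Nat.choose_self, poch_zero, Nat.cast_one]
      linear_combination (Real.Gamma (a + 1 / 2 + n) ^ 2 * Real.Gamma (2 * a + n) *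
        n.factorial / 2 : ℂ) * hsq
    · rw [poch_neg_eq_zero (lt_of_le_of_ne hmn (Ne.symm h))]
      simp
  · intro p hp hne
    have hp' : p.1 + p.2 = m := Finset.HasAntidiagonal.mem_antidiagonal.1 hp
    have : p.1 ≠ m := fun h => hne (Prod.ext h (by simp; omega))
    rw [poch_neg_eq_zero (by omega : p.1 < n)]
    simp
  · intro h
    exact absurd (Finset.HasAntidiagonal.mem_antidiagonal.2 (by simp)) h

/-! ### Exponentially decaying functions are determined by their moments -/

open scoped FourierTransform ContDiff in
/-- Injectivity of the Fourier transform on integrable functions. -/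
lemma ae_eq_zero_of_fourier_eq_zero {g : ℝ → ℂ} (hg : Integrable g) (h : ∀ y, 𝓕 g y = 0) :
    g =ᵐ[volume] 0 := by
  refine ae_eq_zero_of_integral_contDiff_smul_eq_zero hg.locallyIntegrable fun φ hφ hsupp => ?_
  have hφ' : ContDiff ℝ ∞ fun x => (φ x : ℂ) := Complex.ofRealCLM.contDiff.comp hφ
  have hsupp' : HasCompactSupport fun x => (φ x : ℂ) := hsupp.comp_left Complex.ofReal_zero
  let S : SchwartzMap ℝ ℂ := hsupp'.toSchwartzMap hφ'
  obtain ⟨T, hT⟩ : ∃ T : SchwartzMap ℝ ℂ, 𝓕 T = S :=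
    ⟨𝓕⁻ S, FourierTransform.fourier_fourierInv_eq S⟩
  have h1 := VectorFourier.integral_fourierIntegral_smul_eq_flip (L := innerₗ ℝ)
    (μ := volume) (ν := volume) Real.continuous_fourierChar continuous_inner hg
    (T.integrable (μ := volume))
  have h2 (x : ℝ) : VectorFourier.fourierIntegral 𝐞 volume (innerₗ ℝ).flip T x = φ x := by
    have h3 : 𝓕 (T : ℝ → ℂ) x = S x := by
      rw [← SchwartzMap.fourier_coe, hT]
    rw [flip_innerₗ]
    exact h3
  have h4 (y : ℝ) : VectorFourier.fourierIntegral 𝐞 volume (innerₗ ℝ) g y = 0 := h y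
  simp only [h2, h4, smul_eq_mul, zero_mul, integral_zero] at h1
  refine Eq.trans ?_ h1.symm
  exact integral_congr_ae (.of_forall fun x => by simp [mul_comm])

lemma norm_exp_I_mul_le (z : ℂ) (x : ℝ) :
    ‖Complex.exp (Complex.I * z * x)‖ ≤ Real.exp (|z.im| * |x|) := by
  rw [Complex.norm_exp, Real.exp_le_exp]
  have : (Complex.I * z * x).re = -(z.im * x) := by simp
  rw [this, ← abs_mul]
  exact neg_le_abs _

/-- The Fourier transform of an exponentially decaying function extends holomorphically to a
strip. -/
lemma differentiableOn_integral_mul_exp {g : ℝ → ℂ} {δ : ℝ} (hgm : AEStronglyMeasurable g)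
    (hg : Integrable fun x => ‖g x‖ * Real.exp (δ * |x|)) :
    DifferentiableOn ℂ (fun z : ℂ => ∫ x : ℝ, g x * Complex.exp (Complex.I * z * x))
      {z | |z.im| < δ} := by
  intro z₀ hz₀
  have hz₀' : |z₀.im| < δ := hz₀
  set ε := (δ - |z₀.im|) / 2 with hε
  have hε0 : 0 < ε := by linarith
  have him {z : ℂ} (hz : z ∈ Metric.ball z₀ ε) : |z.im| + ε ≤ δ := by
    have h1 : |z.im - z₀.im| ≤ ‖z - z₀‖ := by
      rw [← Complex.sub_im]; exact Complex.abs_im_le_norm _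
    have h2 : ‖z - z₀‖ < ε := by simpa [dist_eq_norm] using hz
    have h3 : |z.im| ≤ |z.im - z₀.im| + |z₀.im| := by
      simpa using abs_add_le (z.im - z₀.im) z₀.im
    linarith
  have hmeas (z : ℂ) : AEStronglyMeasurable fun x : ℝ => g x * Complex.exp (Complex.I * z * x) :=
    hgm.mul (by fun_prop : Continuous fun x : ℝ =>
      Complex.exp (Complex.I * z * x)).aestronglyMeasurable
  have key := hasDerivAt_integral_of_dominated_loc_of_deriv_le (μ := volume)
    (F := fun (z : ℂ) (x : ℝ) => g x * Complex.exp (Complex.I * z * x))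
    (F' := fun (z : ℂ) (x : ℝ) => g x * (Complex.exp (Complex.I * z * x) * (Complex.I * x)))
    (x₀ := z₀) (s := Metric.ball z₀ ε) (bound := fun x => ε⁻¹ * (‖g x‖ * Real.exp (δ * |x|)))
    (Metric.ball_mem_nhds z₀ hε0) (.of_forall hmeas) ?_ ?_ ?_ (hg.const_mul _) ?_
  · exact key.2.differentiableAt.differentiableWithinAt
  · refine hg.mono' (hmeas z₀) (.of_forall fun x => ?_)
    rw [norm_mul]
    refine mul_le_mul_of_nonneg_left ((norm_exp_I_mul_le z₀ x).trans ?_) (norm_nonneg _)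
    exact Real.exp_le_exp.2 (mul_le_mul_of_nonneg_right hz₀'.le (abs_nonneg x))
  · exact hgm.mul (by fun_prop : Continuous fun x : ℝ =>
      Complex.exp (Complex.I * z₀ * x) * (Complex.I * x)).aestronglyMeasurable
  · refine .of_forall fun x z hz => ?_
    rw [norm_mul, norm_mul, norm_mul, Complex.norm_I, one_mul, Complex.norm_real, Real.norm_eq_abs]
    have h1 : ε * |x| ≤ Real.exp (ε * |x|) := by linarith [Real.add_one_le_exp (ε * |x|)]
    have h2 : Real.exp (|z.im| * |x|) * Real.exp (ε * |x|) ≤ Real.exp (δ * |x|) := by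
      rw [← Real.exp_add, ← add_mul]
      exact Real.exp_le_exp.2 (mul_le_mul_of_nonneg_right (him hz) (abs_nonneg x))
    have h3 : ‖Complex.exp (Complex.I * z * x)‖ * (ε * |x|) ≤ Real.exp (δ * |x|) :=
      (mul_le_mul (norm_exp_I_mul_le z x) h1 (by positivity) (Real.exp_pos _).le).trans h2
    rw [← mul_assoc, mul_comm ε⁻¹, mul_assoc ‖g x‖, mul_assoc ‖g x‖]
    refine mul_le_mul_of_nonneg_left ?_ (norm_nonneg _)
    rw [← div_eq_mul_inv, le_div_iff₀ hε0]
    linarith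
  · refine .of_forall fun x z _ => ?_
    have h1 : HasDerivAt (fun z : ℂ => Complex.I * z * x) (Complex.I * x) z := by
      simpa using ((hasDerivAt_id z).const_mul Complex.I).mul_const (x : ℂ)
    exact h1.cexp.const_mul (g x)

/-- A function with exponential decay all of whose moments vanish is zero: its Fourier transform is
holomorphic in a strip and has a vanishing Taylor series at the origin. -/
lemma ae_eq_zero_of_moments_eq_zero {g : ℝ → ℂ} {δ : ℝ} (hδ : 0 < δ)
    (hgm : AEStronglyMeasurable g) (hg : Integrable fun x => ‖g x‖ * Real.exp (δ * |x|))
    (h : ∀ n : ℕ, ∫ x : ℝ, g x * (x : ℂ) ^ n = 0) : g =ᵐ[volume] 0 := by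
  set F : ℂ → ℂ := fun z => ∫ x : ℝ, g x * Complex.exp (Complex.I * z * x) with hF
  have hzero : ∀ z ∈ Metric.ball (0 : ℂ) δ, F z = 0 := by
    intro z hz
    have hz' : ‖z‖ < δ := by simpa using hz
    have hsum := hasSum_integral_of_dominated_convergence (μ := volume)
      (F := fun (n : ℕ) (x : ℝ) => g x * ((Complex.I * z * x) ^ n / n.factorial))
      (f := fun x : ℝ => g x * Complex.exp (Complex.I * z * x))
      (fun n x => ‖g x‖ * ((‖z‖ * |x|) ^ n / n.factorial)) ?_ ?_ ?_ ?_ ?_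
    · refine hsum.unique ?_
      have (n : ℕ) : ∫ x : ℝ, g x * ((Complex.I * z * x) ^ n / n.factorial) = 0 := by
        have h1 (x : ℝ) : g x * ((Complex.I * z * x) ^ n / n.factorial) =
            g x * (x : ℂ) ^ n * ((Complex.I * z) ^ n / n.factorial) := by
          rw [mul_pow]; ring
        simp_rw [h1]
        rw [integral_mul_const, h, zero_mul]
      simp_rw [this]
      exact hasSum_zero
    · intro n
      exact hgm.mul (by fun_prop : Continuous fun x : ℝ =>
        (Complex.I * z * x) ^ n / (n.factorial : ℂ)).aestronglyMeasurable
    · refine fun n => .of_forall fun x => ?_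
      simp
    · exact .of_forall fun x => (Real.summable_pow_div_factorial _).mul_left _
    · simp_rw [tsum_mul_left]
      have (x : ℝ) : ∑' n : ℕ, (‖z‖ * |x|) ^ n / n.factorial = Real.exp (‖z‖ * |x|) := by
        rw [Real.exp_eq_exp_ℝ, NormedSpace.exp_eq_tsum_div]
      simp_rw [this]
      refine hg.mono' (hgm.norm.mul (by fun_prop : Continuous fun x : ℝ =>
        Real.exp (‖z‖ * |x|)).aestronglyMeasurable) (.of_forall fun x => ?_)
      rw [Real.norm_of_nonneg (by positivity)]
      gcongr
    · refine .of_forall fun x => ?_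
      rw [Complex.exp_eq_exp_ℂ]
      exact (NormedSpace.expSeries_div_hasSum_exp (Complex.I * z * x)).mul_left _
  have hopen : IsOpen {z : ℂ | |z.im| < δ} :=
    isOpen_lt (by fun_prop) continuous_const
  have hconv : Convex ℝ {z : ℂ | |z.im| < δ} := by
    have : {z : ℂ | |z.im| < δ} = Complex.imLm ⁻¹' (Ioo (-δ) δ) := by
      ext z; simp [abs_lt]
    rw [this]
    exact (convex_Ioo _ _).linear_preimage _
  have hana := (differentiableOn_integral_mul_exp hgm hg).analyticOnNhd hopen
  have hF0 := hana.eqOn_zero_of_preconnected_of_eventuallyEq_zero hconv.isPreconnected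
    (z₀ := 0) (by simpa using hδ)
    (eventually_of_mem (Metric.ball_mem_nhds (0 : ℂ) hδ) hzero)
  have hgi : Integrable g := by
    refine hg.mono' hgm (.of_forall fun x => ?_)
    exact le_mul_of_one_le_right (norm_nonneg _) (Real.one_le_exp (by positivity))
  refine ae_eq_zero_of_fourier_eq_zero hgi fun y => ?_
  have h1 : F ((-2 * Real.pi * y : ℝ) : ℂ) = 0 := hF0 (by simpa using hδ)
  rw [Real.fourier_real_eq_integral_exp_smul, ← h1]
  refine integral_congr_ae (.of_forall fun x => ?_)
  simp only [smul_eq_mul]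
  rw [mul_comm]
  congr 2
  push_cast
  ring

lemma integrable_mul_pow_of_exp {μ : Measure ℝ} {g : ℝ → ℂ} {δ : ℝ} (hδ : 0 < δ)
    (hgm : AEStronglyMeasurable g μ) (hg : Integrable (fun x => ‖g x‖ * Real.exp (δ * |x|)) μ)
    (n : ℕ) : Integrable (fun x : ℝ => g x * (x : ℂ) ^ n) μ := by
  refine (hg.mul_const (n.factorial / δ ^ n)).mono' (hgm.mul (by fun_prop : Continuous
    fun x : ℝ => (x : ℂ) ^ n).aestronglyMeasurable) (.of_forall fun x => ?_)
  have h1 := Real.pow_div_factorial_le_exp (δ * |x|) (by positivity) n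
  rw [norm_mul, norm_pow, Complex.norm_real, Real.norm_eq_abs, mul_assoc]
  refine mul_le_mul_of_nonneg_left ?_ (norm_nonneg _)
  have hn : (0 : ℝ) < n.factorial := by positivity
  rw [div_le_iff₀ hn, mul_pow] at h1
  rw [mul_div_assoc', le_div_iff₀ (by positivity)]
  linarith

/-- The version on the half-line, where the even moments suffice. -/
lemma ae_eq_zero_of_even_moments_eq_zero {G : ℝ → ℂ} {δ : ℝ} (hδ : 0 < δ)
    (hGm : AEStronglyMeasurable G halfLine)
    (hG : Integrable (fun x => ‖G x‖ * Real.exp (δ * |x|)) halfLine)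
    (h : ∀ n : ℕ, ∫ x : ℝ, G x * (x : ℂ) ^ (2 * n) ∂halfLine = 0) : G =ᵐ[halfLine] 0 := by
  set G₀ : ℝ → ℂ := (Ioi 0).indicator G with hG₀
  have hm₀ : AEStronglyMeasurable G₀ := (aestronglyMeasurable_indicator_iff measurableSet_Ioi).2 hGm
  have hi₀ : Integrable fun x => ‖G₀ x‖ * Real.exp (δ * |x|) := by
    have h1 : (fun x => ‖G₀ x‖ * Real.exp (δ * |x|)) =
        (Ioi 0).indicator fun x => ‖G x‖ * Real.exp (δ * |x|) := by
      ext x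
      by_cases hx : x ∈ Ioi (0 : ℝ)
      · simp [hG₀, hx]
      · simp [hG₀, hx]
    rw [h1]
    exact (integrable_indicator_iff measurableSet_Ioi).2 hG
  have hpow (n : ℕ) : Integrable fun x : ℝ => G₀ x * (x : ℂ) ^ n :=
    integrable_mul_pow_of_exp hδ hm₀ hi₀ n
  have hneg (n : ℕ) : Integrable fun x : ℝ => G₀ (-x) * (x : ℂ) ^ n := by
    refine ((hpow n).comp_neg.const_mul ((-1) ^ n)).congr (.of_forall fun x => ?_)
    beta_reduce
    rw [Complex.ofReal_neg, neg_pow (x : ℂ)]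
    have h1 : (-1 : ℂ) ^ n * (-1) ^ n = 1 := by rw [← mul_pow]; simp
    linear_combination G₀ (-x) * (x : ℂ) ^ n * h1
  have hint (n : ℕ) : ∫ x : ℝ, G₀ (-x) * (x : ℂ) ^ n = (-1) ^ n * ∫ x : ℝ, G₀ x * (x : ℂ) ^ n := by
    rw [← integral_neg_eq_self, ← integral_const_mul]
    refine integral_congr_ae (.of_forall fun x => ?_)
    beta_reduce
    rw [neg_neg, Complex.ofReal_neg, neg_pow (x : ℂ)]
    ring
  have heven (n : ℕ) : ∫ x : ℝ, G₀ x * (x : ℂ) ^ (2 * n) = 0 := by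
    rw [← h n, ← integral_indicator measurableSet_Ioi]
    refine integral_congr_ae (.of_forall fun x => ?_)
    by_cases hx : x ∈ Ioi (0 : ℝ)
    · simp [hG₀, hx]
    · simp [hG₀, hx]
  have hmneg : AEStronglyMeasurable fun x => G₀ (-x) :=
    hm₀.comp_quasiMeasurePreserving (Measure.measurePreserving_neg volume).quasiMeasurePreserving
  have hmain := ae_eq_zero_of_moments_eq_zero (g := fun x => G₀ x + G₀ (-x)) hδ
    (hm₀.add hmneg) ?_ ?_
  · rw [Filter.EventuallyEq, ae_restrict_iff' measurableSet_Ioi]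
    filter_upwards [hmain] with x hx hx0
    have h1 : -x ∉ Ioi (0 : ℝ) := by simpa using (mem_Ioi.1 hx0).le
    simpa [hG₀, hx0, h1] using hx
  · refine (hi₀.add hi₀.comp_neg).mono' ((hm₀.add hmneg).norm.mul (by fun_prop : Continuous
      fun x : ℝ => Real.exp (δ * |x|)).aestronglyMeasurable) (.of_forall fun x => ?_)
    simp only [Pi.add_apply, abs_neg]
    rw [Real.norm_of_nonneg (by positivity), ← add_mul]
    exact mul_le_mul_of_nonneg_right (norm_add_le _ _) (Real.exp_pos _).le
  · intro n
    simp_rw [add_mul]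
    rw [integral_add (hpow n) (hneg n), hint]
    rcases Nat.even_or_odd' n with ⟨k, rfl | rfl⟩
    · rw [heven]; simp
    · rw [pow_succ, pow_mul]; simp

/-! ### The eigenstates form a Hilbert basis of `L²(ℝ₊)` -/

lemma one_lt_gam {c : ℝ} (hc : 0 < c) : 1 < gam c := by
  have h : 1 < Real.sqrt (1 + 2 * c ^ 4) := by
    rw [Real.lt_sqrt zero_le_one]
    have : 0 < c ^ 4 := by positivity
    linarith
  rw [gam]
  linarith

lemma gam_pos {c : ℝ} (hc : 0 < c) : 0 < gam c := zero_lt_one.trans (one_lt_gam hc)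

/-- The factor of the eigenstates that does not depend on `k`. -/
noncomputable def eigenFactor (c ξ : ℝ) : ℂ :=
  (Real.sqrt 2 : ℂ) * Complex.I ^ (gam c : ℂ) * (((c ^ 4)⁻¹ : ℝ) : ℂ) ^ (Complex.I * ξ) *
    Complex.Gamma (gam c + Complex.I * ξ) ^ 2 * (Complex.Gamma (Complex.I * ξ))⁻¹

/-- The normalization constant `Γ(k + γ + 1/2) √(k! Γ(k + 2γ))` of the `k`-th eigenstate. -/
noncomputable def eigenNorm (c : ℝ) (k : ℕ) : ℝ :=
  Real.Gamma (k + gam c + 1 / 2) * Real.sqrt ((k.factorial : ℝ) * Real.Gamma (k + 2 * gam c))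

lemma eigenstate_eq (c : ℝ) (k : ℕ) (ξ : ℝ) : eigenstate c k ξ =
    eigenFactor c ξ / eigenNorm c k * dualHahn k ξ (gam c) (gam c) (1 / 2) := rfl

lemma eigenNorm_pos {c : ℝ} (hc : 0 < c) (k : ℕ) : 0 < eigenNorm c k := by
  have := gam_pos hc
  exact mul_pos (Real.Gamma_pos_of_pos (by positivity))
    (Real.sqrt_pos.2 (mul_pos (by positivity) (Real.Gamma_pos_of_pos (by positivity))))

lemma norm_eigenFactor_sq {c : ℝ} (hc : 0 < c) (ξ : ℝ) :
    ‖eigenFactor c ξ‖ ^ 2 = 2 * dualHahnWeight (gam c) ξ := by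
  have h1 : ‖Complex.I ^ (gam c : ℂ)‖ = 1 := by
    rw [Complex.norm_cpow_real, Complex.norm_I, Real.one_rpow]
  have h2 : ‖(((c ^ 4)⁻¹ : ℝ) : ℂ) ^ (Complex.I * ξ)‖ = 1 := by
    rw [Complex.norm_cpow_eq_rpow_re_of_pos (by positivity)]
    simp
  rw [eigenFactor, norm_mul, norm_mul, norm_mul, norm_mul, h1, h2, norm_pow, norm_inv,
    Complex.norm_real, Real.norm_of_nonneg (Real.sqrt_nonneg 2), dualHahnWeight]
  have h3 := Real.sq_sqrt (zero_le_two (α := ℝ))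
  rw [mul_pow, mul_pow, mul_pow, mul_pow, h3]
  ring

lemma continuous_eigenFactor {c : ℝ} (hc : 0 < c) : Continuous (eigenFactor c) := by
  have h0 : (((c ^ 4)⁻¹ : ℝ) : ℂ) ≠ 0 := by
    rw [Complex.ofReal_ne_zero]
    positivity
  have h1 : Continuous fun ξ : ℝ => (((c ^ 4)⁻¹ : ℝ) : ℂ) ^ (Complex.I * ξ) :=
    Continuous.const_cpow (by fun_prop) (.inl h0)
  have h2 : Continuous fun ξ : ℝ => (Complex.Gamma (Complex.I * ξ))⁻¹ :=
    Complex.differentiable_one_div_Gamma.continuous.comp (by fun_prop)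
  have h3 := continuous_Gamma_line (gam_pos hc)
  unfold eigenFactor
  exact ((continuous_const.mul h1).mul (h3.pow 2)).mul h2

lemma continuous_dualHahn (n : ℕ) (a b d : ℝ) : Continuous fun ξ => dualHahn n ξ a b d := by
  unfold dualHahn
  refine continuous_const.mul (continuous_finsetSum _ fun j _ => ?_)
  simp_rw [poch_eq_prod]
  fun_prop

lemma continuous_eigenstate {c : ℝ} (hc : 0 < c) (k : ℕ) : Continuous (eigenstate c k) :=
  ((continuous_eigenFactor hc).div_const _).mul (continuous_dualHahn _ _ _ _)

lemma conj_eigenstate_mul_eigenstate {c : ℝ} (hc : 0 < c) (k l : ℕ) (ξ : ℝ) :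
    conj (eigenstate c k ξ) * eigenstate c l ξ =
      2 / (eigenNorm c k * eigenNorm c l) * ((dualHahnWeight (gam c) ξ : ℂ) *
        (dualHahn k ξ (gam c) (gam c) (1 / 2) * dualHahn l ξ (gam c) (gam c) (1 / 2))) := by
  have h : eigenFactor c ξ * conj (eigenFactor c ξ) = 2 * (dualHahnWeight (gam c) ξ : ℂ) := by
    rw [Complex.mul_conj', ← Complex.ofReal_pow, norm_eigenFactor_sq hc]
    push_cast
    ring
  rw [eigenstate_eq, eigenstate_eq, map_mul, map_div₀, conj_dualHahn, Complex.conj_ofReal]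
  linear_combination (dualHahn k ξ (gam c) (gam c) (1 / 2) *
    dualHahn l ξ (gam c) (gam c) (1 / 2) / (eigenNorm c k * eigenNorm c l)) * h

lemma memLp_eigenstate {c : ℝ} (hc : 0 < c) (k : ℕ) : MemLp (eigenstate c k) 2 halfLine := by
  rw [memLp_two_iff_integrable_sq_norm (continuous_eigenstate hc k).aestronglyMeasurable]
  have h := ((integrable_weight_mul_dualHahn_mul_dualHahn (gam_pos hc) k k).const_mul
    (2 / (eigenNorm c k * eigenNorm c k) : ℂ)).norm
  refine h.congr (.of_forall fun ξ => ?_)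
  beta_reduce
  rw [← conj_eigenstate_mul_eigenstate hc, norm_mul, Complex.norm_conj, sq]

/-- The eigenstates as elements of `L²(ℝ₊)`. -/
noncomputable def eigenLp {c : ℝ} (hc : 0 < c) (k : ℕ) : Lp ℂ 2 halfLine :=
  (memLp_eigenstate hc k).toLp _

lemma coeFn_eigenLp {c : ℝ} (hc : 0 < c) (k : ℕ) : eigenLp hc k =ᵐ[halfLine] eigenstate c k :=
  MemLp.coeFn_toLp _

lemma inner_eigenLp {c : ℝ} (hc : 0 < c) (k : ℕ) (f : Lp ℂ 2 halfLine) :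
    inner ℂ (eigenLp hc k) f = ∫ ξ, f ξ * conj (eigenstate c k ξ) ∂halfLine := by
  rw [L2.inner_def]
  refine integral_congr_ae ?_
  filter_upwards [coeFn_eigenLp hc k] with ξ hξ
  rw [hξ, RCLike.inner_apply]

lemma orthonormal_eigenLp {c : ℝ} (hc : 0 < c) : Orthonormal ℂ (eigenLp hc) := by
  rw [orthonormal_iff_ite]
  intro k l
  have h1 : inner ℂ (eigenLp hc k) (eigenLp hc l) =
      ∫ ξ, conj (eigenstate c k ξ) * eigenstate c l ξ ∂halfLine := by
    rw [inner_eigenLp]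
    refine integral_congr_ae ?_
    filter_upwards [coeFn_eigenLp hc l] with ξ hξ
    rw [hξ, mul_comm]
  rw [h1]
  simp_rw [conj_eigenstate_mul_eigenstate hc]
  rw [integral_const_mul, integral_weight_mul_dualHahn_mul_dualHahn (gam_pos hc)]
  split_ifs with h
  · subst h
    have hγ := gam_pos hc
    have h2 : eigenNorm c k * eigenNorm c k = Real.Gamma (gam c + 1 / 2 + k) ^ 2 *
        Real.Gamma (2 * gam c + k) * k.factorial := by
      have h3 : 0 ≤ (k.factorial : ℝ) * Real.Gamma (k + 2 * gam c) :=
        mul_nonneg (by positivity) (Real.Gamma_pos_of_pos (by positivity)).le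
      rw [eigenNorm, mul_mul_mul_comm, Real.mul_self_sqrt h3,
        show (k : ℝ) + gam c + 1 / 2 = gam c + 1 / 2 + k by ring, add_comm (k : ℝ)]
      ring
    have h4 : (eigenNorm c k : ℂ) ≠ 0 := Complex.ofReal_ne_zero.2 (eigenNorm_pos hc k).ne'
    rw [← h2]
    push_cast
    field_simp
  · rw [mul_zero]

/-! ### Completeness -/

lemma exists_dualHahnWeight_le {a : ℝ} (ha : 0 < a) : ∃ C, ∀ ξ ∈ Ioi (0 : ℝ),
    dualHahnWeight a ξ ≤ C * Real.exp (-(3 * Real.pi / 8 * |ξ|)) := by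
  obtain ⟨C, hC0, hC⟩ := exists_norm_Gamma_mul_Gamma_le ha ha (θ := 3 * Real.pi / 4)
    (by positivity) (by linarith [Real.pi_pos])
  refine ⟨C ^ 2 * (8 / Real.pi ^ 2), fun ξ hξ => ?_⟩
  have hξ0 : 0 < ξ := hξ
  have h1 : ‖Complex.Gamma (a + Complex.I * ξ)‖ ^ 2 ≤ C * Real.exp (-(3 * Real.pi / 4 * |ξ|)) := by
    have := hC ξ
    rwa [norm_mul, norm_Gamma_line_neg, ← sq] at this
  have h2 : ξ ≤ 8 / Real.pi * Real.exp (Real.pi / 8 * ξ) := by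
    have := Real.add_one_le_exp (Real.pi / 8 * ξ)
    have hpi := Real.pi_pos
    rw [div_mul_eq_mul_div, le_div_iff₀ hpi]
    linarith
  have h3 : Real.sinh (Real.pi * ξ) ≤ Real.exp (Real.pi * ξ) := by
    rw [Real.sinh_eq]
    have := Real.exp_pos (Real.pi * ξ)
    have := Real.exp_pos (-(Real.pi * ξ))
    linarith
  have h4 : 0 ≤ Real.sinh (Real.pi * ξ) := Real.sinh_nonneg_iff.2 (by positivity)
  rw [dualHahnWeight, norm_Gamma_I_mul_sq hξ0, abs_of_pos hξ0] at *
  calc ‖Complex.Gamma (a + Complex.I * ξ)‖ ^ 4 / (Real.pi / (ξ * Real.sinh (Real.pi * ξ)))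
      = (‖Complex.Gamma (a + Complex.I * ξ)‖ ^ 2) ^ 2 *
          (ξ * Real.sinh (Real.pi * ξ)) / Real.pi := by
        rw [div_div_eq_mul_div, ← pow_mul]
    _ ≤ (C * Real.exp (-(3 * Real.pi / 4 * ξ))) ^ 2 *
          (8 / Real.pi * Real.exp (Real.pi / 8 * ξ) * Real.exp (Real.pi * ξ)) / Real.pi := by
        gcongr
    _ = _ := by
        have : Real.exp (-(3 * Real.pi / 8 * ξ)) = Real.exp (-(3 * Real.pi / 4 * ξ)) ^ 2 *
            Real.exp (Real.pi / 8 * ξ) * Real.exp (Real.pi * ξ) := by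
          rw [← Real.exp_nat_mul, ← Real.exp_add, ← Real.exp_add]
          congr 1
          push_cast
          ring
        rw [this]
        ring

/-- The eigenstates decay fast enough that multiplication by their common factor turns `L²`
functions into exponentially decaying ones. -/
lemma integrable_mul_conj_eigenFactor_mul_exp {c : ℝ} (hc : 0 < c) {f : ℝ → ℂ}
    (hf : MemLp f 2 halfLine) :
    Integrable (fun ξ => ‖f ξ * conj (eigenFactor c ξ)‖ * Real.exp (Real.pi / 8 * |ξ|))
      halfLine := by
  have hcont : Continuous fun ξ : ℝ => eigenFactor c ξ * (Real.exp (Real.pi / 8 * |ξ|) : ℂ) :=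
    (continuous_eigenFactor hc).mul (by fun_prop)
  have hm : MemLp (fun ξ : ℝ => eigenFactor c ξ * (Real.exp (Real.pi / 8 * |ξ|) : ℂ)) 2
      halfLine := by
    rw [memLp_two_iff_integrable_sq_norm hcont.aestronglyMeasurable]
    obtain ⟨C, hC⟩ := exists_dualHahnWeight_le (gam_pos hc)
    refine (((integrable_exp_neg_mul_abs (δ := Real.pi / 8) (by positivity)).integrableOn
      (s := Ioi 0)).const_mul (2 * C)).mono' (hcont.norm.pow 2).aestronglyMeasurable ?_
    refine (ae_restrict_iff' measurableSet_Ioi).2 (.of_forall fun ξ hξ => ?_)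
    rw [Real.norm_of_nonneg (by positivity), norm_mul, mul_pow, norm_eigenFactor_sq hc,
      Complex.norm_real, Real.norm_of_nonneg (Real.exp_pos _).le, ← Real.exp_nat_mul]
    have h1 : Real.exp (-(Real.pi / 8 * |ξ|)) = Real.exp (-(3 * Real.pi / 8 * |ξ|)) *
        Real.exp ((2 : ℕ) * (Real.pi / 8 * |ξ|)) := by
      rw [← Real.exp_add]
      congr 1
      push_cast
      ring
    rw [h1]
    refine (mul_le_mul_of_nonneg_right (mul_le_mul_of_nonneg_left (hC ξ hξ) zero_le_two)
      (Real.exp_pos _).le).trans (le_of_eq ?_)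
    ring
  refine (hf.integrable_mul hm).norm.congr (.of_forall fun ξ => ?_)
  simp only [Pi.mul_apply, norm_mul, Complex.norm_conj, Complex.norm_real]
  rw [Real.norm_of_nonneg (Real.exp_pos _).le, mul_assoc]

open Polynomial in
/-- The product `(a + iξ)_j (a - iξ)_j` as a polynomial in `ξ`. -/
noncomputable def pochPoly (a : ℝ) (j : ℕ) : ℂ[X] :=
  ∏ i ∈ Finset.range j, (C (((a + i) ^ 2 : ℝ) : ℂ) + X ^ 2)

lemma eval_pochPoly (a ξ : ℝ) (j : ℕ) :
    (pochPoly a j).eval (ξ : ℂ) = poch (a + Complex.I * ξ) j * poch (a - Complex.I * ξ) j := by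
  rw [pochPoly, Polynomial.eval_prod, poch_eq_prod, poch_eq_prod, ← Finset.prod_mul_distrib]
  refine Finset.prod_congr rfl fun i _ => ?_
  simp only [Polynomial.eval_add, Polynomial.eval_C, Polynomial.eval_pow, Polynomial.eval_X]
  push_cast
  linear_combination (ξ : ℂ) ^ 2 * Complex.I_sq

/-- A function of `L²(ℝ₊)` that is orthogonal to all eigenstates vanishes. -/
lemma ae_eq_zero_of_forall_integral_mul_conj_eigenstate {c : ℝ} (hc : 0 < c) {f : ℝ → ℂ}
    (hf : MemLp f 2 halfLine) (h : ∀ k, ∫ ξ, f ξ * conj (eigenstate c k ξ) ∂halfLine = 0) :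
    f =ᵐ[halfLine] 0 := by
  have hγ := gam_pos hc
  set G : ℝ → ℂ := fun ξ => f ξ * conj (eigenFactor c ξ) with hG
  have hGm : AEStronglyMeasurable G halfLine := hf.1.mul
    (Complex.continuous_conj.comp (continuous_eigenFactor hc)).aestronglyMeasurable
  have hpi : 0 < Real.pi / 8 := by positivity
  have hGi := integrable_mul_conj_eigenFactor_mul_exp hc hf
  have hpoly (P : Polynomial ℂ) : Integrable (fun ξ : ℝ => G ξ * P.eval (ξ : ℂ)) halfLine := by
    simp_rw [Polynomial.eval_eq_sum_range, Finset.mul_sum]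
    refine integrable_finsetSum _ fun n _ => ?_
    refine ((integrable_mul_pow_of_exp hpi hGm hGi n).const_mul (P.coeff n)).congr
      (.of_forall fun ξ => ?_)
    ring
  have hS (n : ℕ) : ∫ ξ, G ξ * dualHahn n ξ (gam c) (gam c) (1 / 2) ∂halfLine = 0 := by
    have h1 := h n
    have h2 (ξ : ℝ) : f ξ * conj (eigenstate c n ξ) =
        (eigenNorm c n : ℂ)⁻¹ * (G ξ * dualHahn n ξ (gam c) (gam c) (1 / 2)) := by
      rw [eigenstate_eq, map_mul, map_div₀, conj_dualHahn, Complex.conj_ofReal, hG]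
      ring
    simp_rw [h2] at h1
    rw [integral_const_mul] at h1
    refine (mul_eq_zero.1 h1).resolve_left (inv_ne_zero ?_)
    exact Complex.ofReal_ne_zero.2 (eigenNorm_pos hc n).ne'
  have hp (j : ℕ) : ∫ ξ : ℝ, G ξ * (pochPoly (gam c) j).eval (ξ : ℂ) ∂halfLine = 0 := by
    induction j using Nat.strong_induction_on with
    | _ n ih =>
      have h1 (ξ : ℝ) : G ξ * dualHahn n ξ (gam c) (gam c) (1 / 2) =
          ∑ p ∈ Finset.HasAntidiagonal.antidiagonal n, (-1) ^ p.1 * (n.choose p.1 : ℂ) *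
            (poch (2 * gam c + p.1) p.2 * poch ((gam c + 1 / 2 : ℝ) + p.1) p.2) *
            (G ξ * (pochPoly (gam c) p.1).eval (ξ : ℂ)) := by
        rw [dualHahn_half_eq_sum n ξ hγ, Finset.mul_sum]
        refine Finset.sum_congr rfl fun p _ => ?_
        rw [eval_pochPoly]
        ring
      have h2 := hS n
      simp_rw [h1] at h2
      rw [integral_finsetSum _ fun p _ => (hpoly _).const_mul _] at h2
      simp_rw [integral_const_mul] at h2
      rw [Finset.sum_eq_single (n, 0)] at h2
      · simpa using h2
      · intro p hp hne
        have hp' : p.1 + p.2 = n := Finset.HasAntidiagonal.mem_antidiagonal.1 hp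
        have hlt : p.1 ≠ n := fun h => hne (Prod.ext h (by simp; omega))
        rw [ih p.1 (by omega), mul_zero]
      · intro h
        exact absurd (Finset.HasAntidiagonal.mem_antidiagonal.2 (by simp)) h
  have hpX (n : ℕ) : ∀ j, ∫ ξ : ℝ,
      G ξ * (pochPoly (gam c) j * Polynomial.X ^ (2 * n)).eval (ξ : ℂ) ∂halfLine = 0 := by
    induction n with
    | zero => simpa using hp
    | succ n ih =>
      intro j
      have h1 : pochPoly (gam c) j * Polynomial.X ^ (2 * (n + 1)) =
          pochPoly (gam c) (j + 1) * Polynomial.X ^ (2 * n) -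
            Polynomial.C (((gam c + j) ^ 2 : ℝ) : ℂ) *
              (pochPoly (gam c) j * Polynomial.X ^ (2 * n)) := by
        rw [pochPoly, pochPoly, Finset.prod_range_succ]
        ring
      have h2 (ξ : ℝ) : G ξ * (pochPoly (gam c) j * Polynomial.X ^ (2 * (n + 1))).eval (ξ : ℂ) =
          G ξ * (pochPoly (gam c) (j + 1) * Polynomial.X ^ (2 * n)).eval (ξ : ℂ) -
            (((gam c + j) ^ 2 : ℝ) : ℂ) *
              (G ξ * (pochPoly (gam c) j * Polynomial.X ^ (2 * n)).eval (ξ : ℂ)) := by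
        rw [h1, Polynomial.eval_sub, Polynomial.eval_mul (p := Polynomial.C _), Polynomial.eval_C]
        ring
      simp_rw [h2]
      rw [integral_sub (hpoly _) ((hpoly _).const_mul _), integral_const_mul, ih, ih, mul_zero,
        sub_zero]
  have hG0 := ae_eq_zero_of_even_moments_eq_zero hpi hGm hGi fun n => by
    simpa [pochPoly] using hpX n 0
  filter_upwards [hG0, ae_restrict_mem measurableSet_Ioi] with ξ hξ hξ0
  have hξ' : (0 : ℝ) < ξ := hξ0
  have hne : eigenFactor c ξ ≠ 0 := by
    intro h0
    have h1 := norm_eigenFactor_sq hc ξ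
    have h2 : 0 < dualHahnWeight (gam c) ξ := by
      rw [dualHahnWeight, norm_Gamma_I_mul_sq hξ']
      have h3 : 0 < Real.sinh (Real.pi * ξ) := Real.sinh_pos_iff.2 (by positivity)
      have h4 : 0 < ‖Complex.Gamma (gam c + Complex.I * ξ)‖ :=
        norm_pos_iff.2 (Complex.Gamma_ne_zero_of_re_pos (by simpa))
      positivity
    rw [h0, norm_zero] at h1
    linarith
  exact (mul_eq_zero.1 hξ).resolve_right ((map_ne_zero _).2 hne)

/-- The Hilbert basis of eigenstates. -/
noncomputable def eigenBasis {c : ℝ} (hc : 0 < c) : HilbertBasis ℕ ℂ (Lp ℂ 2 halfLine) :=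
  HilbertBasis.mkOfOrthogonalEqBot (orthonormal_eigenLp hc) (by
    rw [Submodule.eq_bot_iff]
    intro f hf
    have h (k : ℕ) : ∫ ξ, f ξ * conj (eigenstate c k ξ) ∂halfLine = 0 := by
      rw [← inner_eigenLp hc]
      exact (Submodule.mem_orthogonal _ _).1 hf _ (Submodule.subset_span (mem_range_self k))
    exact (Lp.eq_zero_iff_ae_eq_zero).2
      (ae_eq_zero_of_forall_integral_mul_conj_eigenstate hc (Lp.memLp f) h))

@[simp] lemma coe_eigenBasis {c : ℝ} (hc : 0 < c) : ⇑(eigenBasis hc) = eigenLp hc :=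
  HilbertBasis.coe_mkOfOrthogonalEqBot _ _

/-! ### Taylor coefficients as integrals over the weighted disk -/

lemma setIntegral_pow_mul_one_sub_sq_rpow (k : ℕ) {s : ℝ} (hs : 1 < s) :
    ∫ r in Ioo (0 : ℝ) 1, r ^ (2 * k + 1) * (1 - r ^ 2) ^ (s - 2) =
      k.factorial * Real.Gamma (s - 1) / (2 * Real.Gamma (s + k)) := by
  have himage : (fun r : ℝ => r ^ 2) '' Ioo 0 1 = Ioo 0 1 := by
    ext x
    constructor
    · rintro ⟨r, ⟨h0, h1⟩, rfl⟩
      exact ⟨by positivity, pow_lt_one₀ h0.le h1 two_ne_zero⟩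
    · rintro ⟨h0, h1⟩
      exact ⟨√x, ⟨Real.sqrt_pos.2 h0, by rwa [Real.sqrt_lt' one_pos, one_pow]⟩,
        Real.sq_sqrt h0.le⟩
  have h1 : ∫ x in Ioo (0 : ℝ) 1, x ^ k * (1 - x) ^ (s - 2) =
      2 * ∫ r in Ioo (0 : ℝ) 1, r ^ (2 * k + 1) * (1 - r ^ 2) ^ (s - 2) := by
    rw [← himage, integral_image_eq_integral_abs_deriv_smul measurableSet_Ioo
      (fun r _ => (hasDerivAt_pow 2 r).hasDerivWithinAt), himage, ← integral_const_mul]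
    · refine setIntegral_congr_fun measurableSet_Ioo fun r hr => ?_
      simp only [smul_eq_mul]
      rw [abs_of_nonneg (by have := hr.1.le; positivity)]
      push_cast
      ring
    · intro x hx y hy hxy
      exact (pow_left_inj₀ hx.1.le hy.1.le two_ne_zero).1 hxy
  have h2 : ((∫ x in Ioo (0 : ℝ) 1, x ^ k * (1 - x) ^ (s - 2) : ℝ) : ℂ) =
      Complex.betaIntegral (k + 1) ((s - 1 : ℝ) : ℂ) := by
    rw [Complex.betaIntegral, intervalIntegral.integral_of_le zero_le_one,
      integral_Ioc_eq_integral_Ioo, ← integral_complex_ofReal]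
    refine setIntegral_congr_fun measurableSet_Ioo fun x hx => ?_
    rw [Complex.ofReal_mul, Complex.ofReal_cpow (by linarith [hx.2])]
    push_cast
    rw [add_sub_cancel_right, Complex.cpow_natCast]
    congr 2
    ring
  rw [Complex.betaIntegral_eq_Gamma_mul_div _ _ (by simp; positivity) (by simpa using hs),
    Complex.Gamma_nat_eq_factorial, Complex.Gamma_ofReal,
    show (k : ℂ) + 1 + ((s - 1 : ℝ) : ℂ) = ((s + k : ℝ) : ℂ) by push_cast; ring,
    Complex.Gamma_ofReal, h1] at h2
  have h3 : 2 * ∫ r in Ioo (0 : ℝ) 1, r ^ (2 * k + 1) * (1 - r ^ 2) ^ (s - 2) =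
      k.factorial * Real.Gamma (s - 1) / Real.Gamma (s + k) := by exact_mod_cast h2
  rw [mul_comm (2 : ℝ) (Real.Gamma _), ← div_div, ← h3]
  ring

/-- Cauchy's formula for the Taylor coefficients at `0`, on a circle of radius `r < 1`. -/
lemma setIntegral_conj_circleMap_pow_mul {φ : ℂ → ℂ}
    (hφ : DifferentiableOn ℂ φ (Metric.ball 0 1)) (k : ℕ) {r : ℝ} (h0 : 0 < r) (h1 : r < 1) :
    ∫ θ in Ioo (-Real.pi) Real.pi, conj (circleMap 0 r θ) ^ k * φ (circleMap 0 r θ) =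
      2 * Real.pi * r ^ (2 * k) * (iteratedDeriv k φ 0 / k.factorial) := by
  lift r to NNReal using h0.le
  have hr0 : 0 < r := by exact_mod_cast h0
  have hsub : Metric.closedBall (0 : ℂ) r ⊆ Metric.ball 0 1 :=
    Metric.closedBall_subset_ball h1
  have hp := (hφ.mono hsub).hasFPowerSeriesOnBall hr0
  have hq : AnalyticAt ℂ φ 0 := hp.analyticAt
  have hcoef : (cauchyPowerSeries φ 0 r k fun _ => 1) = iteratedDeriv k φ 0 / k.factorial := by
    rw [hp.hasFPowerSeriesAt.eq_formalMultilinearSeries hq.hasFPowerSeriesAt]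
    simp [FormalMultilinearSeries.ofScalars]
  have hper : Function.Periodic
      (fun θ => conj (circleMap 0 r θ) ^ k * φ (circleMap 0 r θ)) (2 * Real.pi) :=
    (periodic_circleMap 0 (r : ℝ)).comp fun z => conj z ^ k * φ z
  have hshift := hper.intervalIntegral_add_eq (-Real.pi) 0
  rw [show -Real.pi + 2 * Real.pi = Real.pi by ring, zero_add] at hshift
  rw [← integral_Ioc_eq_integral_Ioo, ← intervalIntegral.integral_of_le
    (by linarith [Real.pi_pos]), hshift, ← hcoef, cauchyPowerSeries_apply, circleIntegral]
  have hpt (θ : ℝ) : conj (circleMap 0 r θ) ^ k * φ (circleMap 0 r θ) =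
      (r : ℂ) ^ (2 * k) / Complex.I * (deriv (circleMap 0 (r : ℝ)) θ •
        (1 / (circleMap 0 r θ - 0)) ^ k • (circleMap 0 r θ - 0)⁻¹ • φ (circleMap 0 r θ)) := by
    have hne : circleMap 0 (r : ℝ) θ ≠ 0 := circleMap_ne_center (by exact_mod_cast hr0.ne')
    have hcc : conj (circleMap 0 (r : ℝ) θ) * circleMap 0 r θ = (r : ℂ) ^ 2 := by
      rw [Complex.conj_mul', norm_circleMap_zero]
      simp
    rw [deriv_circleMap, smul_eq_mul, smul_eq_mul, smul_eq_mul, sub_zero, pow_mul, ← hcc, mul_pow,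
      one_div, inv_pow]
    field_simp
  simp_rw [hpt]
  rw [intervalIntegral.integral_const_mul, smul_eq_mul]
  have hpi : (Real.pi : ℂ) ≠ 0 := Complex.ofReal_ne_zero.2 Real.pi_ne_zero
  field_simp

lemma measurable_diskDensity (s : ℝ) :
    Measurable fun z : ℂ => ENNReal.ofReal ((1 - ‖z‖ ^ 2) ^ (s - 2)) := by
  fun_prop

lemma toReal_diskDensity (s : ℝ) {z : ℂ} (hz : ‖z‖ < 1) :
    (ENNReal.ofReal ((1 - ‖z‖ ^ 2) ^ (s - 2))).toReal = (1 - ‖z‖ ^ 2) ^ (s - 2) := by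
  refine ENNReal.toReal_ofReal (Real.rpow_nonneg ?_ _)
  have := pow_lt_one₀ (norm_nonneg z) hz two_ne_zero
  linarith

/-- Integration against `diskMeasure` in polar coordinates. -/
lemma integral_diskMeasure (s : ℝ) {g : ℂ → ℂ} (hg : Integrable g (diskMeasure s)) :
    ∫ z, g z ∂diskMeasure s = ∫ r in Ioo (0 : ℝ) 1, (r * (1 - r ^ 2) ^ (s - 2) : ℝ) *
      ∫ θ in Ioo (-Real.pi) Real.pi, g (circleMap 0 r θ) := by
  have hlt : ∀ᵐ z ∂volume.restrict (Metric.ball (0 : ℂ) 1),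
      ENNReal.ofReal ((1 - ‖z‖ ^ 2) ^ (s - 2)) < ⊤ := .of_forall fun _ => ENNReal.ofReal_lt_top
  rw [diskMeasure, integrable_withDensity_iff_integrable_smul' (measurable_diskDensity s) hlt,
    ← IntegrableOn, ← integrable_indicator_iff Metric.isOpen_ball.measurableSet] at hg
  rw [diskMeasure, integral_withDensity_eq_integral_toReal_smul (measurable_diskDensity s) hlt,
    ← integral_indicator Metric.isOpen_ball.measurableSet]
  set G : ℂ → ℂ := (Metric.ball (0 : ℂ) 1).indicator fun z =>
    (ENNReal.ofReal ((1 - ‖z‖ ^ 2) ^ (s - 2))).toReal • g z with hG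
  have hsymm (p : ℝ × ℝ) : Complex.polarCoord.symm p = circleMap 0 p.1 p.2 := by
    rw [Complex.polarCoord_symm_apply, circleMap_zero, Complex.exp_mul_I, Complex.ofReal_cos,
      Complex.ofReal_sin]
  rw [← Complex.integral_comp_polarCoord_symm]
  have hint : IntegrableOn (fun p : ℝ × ℝ => p.1 • G (Complex.polarCoord.symm p))
      polarCoord.target := by
    have h1 : Integrable (fun p : ℝ × ℝ => G (Complex.measurableEquivRealProd.symm p)) :=
      Complex.volume_preserving_equiv_real_prod.symm.integrable_comp_of_integrable hg
    have h2 := (integrableOn_image_iff_integrableOn_abs_det_fderiv_smul volume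
      polarCoord.open_target.measurableSet
      (fun p _ => (hasFDerivAt_polarCoord_symm p).hasFDerivWithinAt) polarCoord.symm.injOn _).1
      (h1.integrableOn (s := polarCoord.symm '' polarCoord.target))
    refine h2.congr_fun (fun p hp => ?_) polarCoord.open_target.measurableSet
    simp only [det_fderivPolarCoordSymm]
    rw [abs_of_pos hp.1]
    rfl
  rw [polarCoord_target] at hint ⊢
  rw [Measure.volume_eq_prod] at hint ⊢
  rw [setIntegral_prod _ hint]
  have hinner : ∀ r ∈ Ioi (0 : ℝ), ∫ θ in Ioo (-Real.pi) Real.pi,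
      (r, θ).1 • G (Complex.polarCoord.symm (r, θ)) =
      (Iio (1 : ℝ)).indicator (fun r => ((r * (1 - r ^ 2) ^ (s - 2) : ℝ) : ℂ) *
        ∫ θ in Ioo (-Real.pi) Real.pi, g (circleMap 0 r θ)) r := by
    intro r hr
    have hr' : (0 : ℝ) < r := hr
    have hnorm (θ : ℝ) : ‖circleMap 0 r θ‖ = r := by rw [norm_circleMap_zero, abs_of_pos hr']
    simp_rw [hsymm]
    by_cases h : r < 1
    · rw [indicator_of_mem (show r ∈ Iio 1 from h), ← integral_const_mul]
      refine integral_congr_ae (.of_forall fun θ => ?_)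
      have hmem : circleMap 0 r θ ∈ Metric.ball (0 : ℂ) 1 := by
        rw [mem_ball_zero_iff, hnorm]
        exact h
      simp only [hG, indicator_of_mem hmem]
      rw [toReal_diskDensity s (by rwa [hnorm]), hnorm, Complex.real_smul, Complex.real_smul,
        Complex.ofReal_mul, mul_assoc]
    · rw [indicator_of_notMem (show r ∉ Iio 1 from h)]
      refine integral_eq_zero_of_ae (.of_forall fun θ => ?_)
      have hmem : circleMap 0 r θ ∉ Metric.ball (0 : ℂ) 1 := by
        rw [mem_ball_zero_iff, hnorm]
        exact h
      simp only [hG, indicator_of_notMem hmem, smul_zero, Pi.zero_apply]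
  rw [setIntegral_congr_fun measurableSet_Ioi hinner, setIntegral_indicator measurableSet_Iio,
    Ioi_inter_Iio]

/-- The weighted integral of a holomorphic function against `conj z ^ k` is a multiple of its
`k`-th Taylor coefficient. -/
lemma integral_conj_pow_mul {s : ℝ} (hs : 1 < s) {φ : ℂ → ℂ}
    (hφ : DifferentiableOn ℂ φ (Metric.ball 0 1)) (k : ℕ)
    (hint : Integrable (fun z => conj z ^ k * φ z) (diskMeasure s)) :
    ∫ z, conj z ^ k * φ z ∂diskMeasure s =
      (Real.pi * k.factorial * Real.Gamma (s - 1) / Real.Gamma (s + k) : ℝ) *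
        (iteratedDeriv k φ 0 / k.factorial) := by
  rw [integral_diskMeasure s hint]
  have h1 : ∀ r ∈ Ioo (0 : ℝ) 1, ((r * (1 - r ^ 2) ^ (s - 2) : ℝ) : ℂ) *
      ∫ θ in Ioo (-Real.pi) Real.pi, conj (circleMap 0 r θ) ^ k * φ (circleMap 0 r θ) =
      ((r ^ (2 * k + 1) * (1 - r ^ 2) ^ (s - 2) : ℝ) : ℂ) *
        (2 * Real.pi * (iteratedDeriv k φ 0 / k.factorial)) := by
    intro r hr
    rw [setIntegral_conj_circleMap_pow_mul hφ k hr.1 hr.2]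
    push_cast
    ring
  rw [setIntegral_congr_fun measurableSet_Ioo h1, integral_mul_const, integral_complex_ofReal,
    setIntegral_pow_mul_one_sub_sq_rpow k hs]
  push_cast
  ring

/-! ### The basis functions of the disk for `m = 0` -/

/-- The constant `√((s - 1) Γ(s + k) / (π Γ(s) k!))` that normalizes the monomial `z ^ k` in the
Bergman space of weight `s`. -/
noncomputable def diskCoeff (s : ℝ) (k : ℕ) : ℝ :=
  √((s - 1) * Real.Gamma (s + k) / (Real.pi * Real.Gamma s * k.factorial))

lemma diskCoeff_sq {s : ℝ} (hs : 1 < s) (k : ℕ) : diskCoeff s k ^ 2 =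
    (s - 1) * Real.Gamma (s + k) / (Real.pi * Real.Gamma s * k.factorial) := by
  have h1 : 0 < Real.Gamma s := Real.Gamma_pos_of_pos (by positivity)
  have h2 : 0 < Real.Gamma (s + k) := Real.Gamma_pos_of_pos (by positivity)
  have h3 : 0 < s - 1 := by linarith
  exact Real.sq_sqrt (by positivity)

lemma diskCoeff_pos {s : ℝ} (hs : 1 < s) (k : ℕ) : 0 < diskCoeff s k := by
  have h1 : 0 < Real.Gamma s := Real.Gamma_pos_of_pos (by positivity)
  have h2 : 0 < Real.Gamma (s + k) := Real.Gamma_pos_of_pos (by positivity)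
  have h3 : 0 < s - 1 := by linarith
  exact Real.sqrt_pos.2 (by positivity)

lemma ascPochhammer_eval_eq_Gamma_div {s : ℝ} (hs : 0 < s) (k : ℕ) :
    (ascPochhammer ℝ k).eval s = Real.Gamma (s + k) / Real.Gamma s := by
  have h1 : (Real.Gamma s : ℂ) ≠ 0 := Complex.ofReal_ne_zero.2 (Real.Gamma_pos_of_pos hs).ne'
  have h2 : (((ascPochhammer ℝ k).eval s : ℝ) : ℂ) = poch s k := by
    rw [poch, ← ascPochhammer_map Complex.ofRealHom, Polynomial.eval_map]
    exact (Polynomial.eval₂_at_apply Complex.ofRealHom s).symm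
  rw [← Complex.ofReal_inj, h2, Complex.ofReal_div, ofReal_Gamma_add_nat hs,
    mul_div_cancel_right₀ _ h1]

/-- For `α = -k` only the top term of the Jacobi polynomial survives. -/
lemma jacobi_neg_nat (k : ℕ) {s : ℝ} (hs : 0 < s) (x : ℝ) :
    jacobi k (-k) (s - 1) (1 - 2 * x) =
      Real.Gamma (s + k) / (Real.Gamma s * k.factorial) * (-x) ^ k := by
  rw [jacobi, Finset.sum_range_succ, Finset.sum_eq_zero, Nat.choose_self, Nat.sub_self,
    show (k : ℝ) + -k + (s - 1) + 1 = s by ring, ascPochhammer_eval_eq_Gamma_div hs]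
  · have : (1 - 2 * x - 1) / 2 = -x := by ring
    rw [this]
    simp
    ring
  · intro j hj
    have hj' := Finset.mem_range.1 hj
    have h : (ascPochhammer ℝ (k - j)).eval (-(k : ℝ) + j + 1) = 0 := by
      rw [ascPochhammer_eval_eq_zero_iff]
      refine ⟨k - j - 1, by omega, ?_⟩
      rw [Nat.sub_sub, Nat.cast_sub (by omega)]
      push_cast
      ring
    rw [h, mul_zero, zero_mul]

lemma landauBasis_zero {s : ℝ} (hs : 1 < s) (k : ℕ) (z : ℂ) :
    landauBasis s 0 k z = diskCoeff s k * z ^ k := by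
  have hs0 : 0 < s := by linarith
  have hs1 : 0 < s - 1 := by linarith
  have h1 := Real.Gamma_pos_of_pos hs0
  have h2 : 0 < Real.Gamma (s + k) := Real.Gamma_pos_of_pos (by positivity)
  -- both square roots agree up to the factor `Γ(s + k) / (Γ(s) k!)` of the Jacobi polynomial
  have hcoef : √((s - 1) * Real.Gamma s * k.factorial / (Real.pi * Real.Gamma (s + k))) *
      (Real.Gamma (s + k) / (Real.Gamma s * k.factorial)) = diskCoeff s k := by
    rw [diskCoeff, ← Real.sqrt_mul_self
      (show 0 ≤ Real.Gamma (s + k) / (Real.Gamma s * k.factorial) by positivity),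
      ← Real.sqrt_mul (by positivity)]
    congr 1
    field_simp
  have hz : (-1 : ℂ) ^ k * conj z ^ (-(k : ℤ)) * (-(‖z‖ ^ 2 : ℝ) : ℂ) ^ k = z ^ k := by
    rw [zpow_neg, zpow_natCast, mul_right_comm, ← mul_pow, neg_one_mul, neg_neg,
      Complex.ofReal_pow, ← Complex.conj_mul', mul_pow]
    rcases eq_or_ne z 0 with rfl | h
    · rcases eq_or_ne k 0 with rfl | hk
      · simp
      · simp [hk]
    · have : conj z ^ k ≠ 0 := pow_ne_zero _ ((map_ne_zero _).2 h)
      field_simp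
  rw [landauBasis, ← hz, ← hcoef]
  have hj := jacobi_neg_nat k hs0 (‖z‖ ^ 2)
  simp only [mul_zero, sub_zero, Nat.factorial_zero, Nat.cast_one, mul_one,
    CharP.cast_eq_zero, zero_sub, pow_zero, Complex.ofReal_one, div_one]
  rw [hj]
  push_cast
  ring

lemma diskCoeff_sq_eq_poch {s : ℝ} (hs : 1 < s) (k : ℕ) :
    ((diskCoeff s k ^ 2 : ℝ) : ℂ) = (s - 1) / Real.pi * (poch s k / k.factorial) := by
  have hs0 : 0 < s := by linarith
  have h1 : (Real.Gamma s : ℂ) ≠ 0 := Complex.ofReal_ne_zero.2 (Real.Gamma_pos_of_pos hs0).ne'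
  rw [diskCoeff_sq hs]
  push_cast
  rw [ofReal_Gamma_add_nat hs0]
  field_simp

lemma summable_diskCoeff_sq_mul_pow {s : ℝ} (hs : 1 < s) {r : ℝ} (h0 : 0 ≤ r) (h1 : r < 1) :
    Summable fun k : ℕ => diskCoeff s k ^ 2 * r ^ k := by
  have h := (norm_summable_and_hasSum_one_sub_cpow s (z := r)
    (by rwa [Complex.norm_real, Real.norm_of_nonneg h0])).1.mul_left ‖((s : ℂ) - 1) / Real.pi‖
  refine h.congr fun k => ?_
  rw [← norm_mul, ← mul_assoc, ← diskCoeff_sq_eq_poch hs, ← Complex.ofReal_pow,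
    ← Complex.ofReal_mul, Complex.norm_real, Real.norm_of_nonneg (by positivity)]

lemma summable_norm_diskCoeff_mul_pow_sq {s : ℝ} (hs : 1 < s) {z : ℂ} (hz : ‖z‖ < 1) :
    Summable fun k : ℕ => ‖(diskCoeff s k : ℂ) * z ^ k‖ ^ 2 := by
  refine (summable_diskCoeff_sq_mul_pow hs (sq_nonneg ‖z‖)
    (pow_lt_one₀ (norm_nonneg z) hz two_ne_zero)).congr fun k => ?_
  rw [norm_mul, mul_pow, Complex.norm_real, Real.norm_of_nonneg (diskCoeff_pos hs k).le, norm_pow,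
    ← pow_mul, ← pow_mul, mul_comm k]

lemma ae_diskMeasure_norm_lt_one (s : ℝ) : ∀ᵐ z ∂diskMeasure s, ‖z‖ < 1 := by
  refine (withDensity_absolutelyContinuous _ _).ae_le ?_
  filter_upwards [ae_restrict_mem Metric.isOpen_ball.measurableSet] with z hz
  exact mem_ball_zero_iff.1 hz

lemma isFiniteMeasure_diskMeasure {s : ℝ} (hs : 2 ≤ s) : IsFiniteMeasure (diskMeasure s) := by
  refine isFiniteMeasure_withDensity (ne_of_lt ?_)
  calc ∫⁻ z in Metric.ball (0 : ℂ) 1, ENNReal.ofReal ((1 - ‖z‖ ^ 2) ^ (s - 2))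
      ≤ ∫⁻ _ in Metric.ball (0 : ℂ) 1, 1 := by
        refine setLIntegral_mono' Metric.isOpen_ball.measurableSet fun z hz => ?_
        have hz' := pow_lt_one₀ (norm_nonneg z) (mem_ball_zero_iff.1 hz) two_ne_zero
        rw [ENNReal.ofReal_le_one]
        exact Real.rpow_le_one (by linarith) (by linarith [sq_nonneg ‖z‖]) (by linarith)
    _ < ⊤ := by
        rw [lintegral_one, Measure.restrict_apply_univ]
        exact measure_ball_lt_top

lemma memLp_diskCoeff_mul_pow {s : ℝ} (hs : 2 ≤ s) (k : ℕ) :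
    MemLp (fun z : ℂ => (diskCoeff s k : ℂ) * z ^ k) 2 (diskMeasure s) := by
  have := isFiniteMeasure_diskMeasure hs
  refine MemLp.of_bound (C := ‖(diskCoeff s k : ℂ)‖)
    (by fun_prop : Continuous _).aestronglyMeasurable ?_
  filter_upwards [ae_diskMeasure_norm_lt_one s] with z hz
  rw [norm_mul, norm_pow]
  exact mul_le_of_le_one_right (norm_nonneg _) (pow_le_one₀ (norm_nonneg z) hz.le)

/-- The normalized monomials as elements of `L²`. -/
noncomputable def diskLp {s : ℝ} (hs : 2 ≤ s) (k : ℕ) : Lp ℂ 2 (diskMeasure s) :=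
  (memLp_diskCoeff_mul_pow hs k).toLp _

lemma coeFn_diskLp {s : ℝ} (hs : 2 ≤ s) (k : ℕ) :
    diskLp hs k =ᵐ[diskMeasure s] fun z : ℂ => (diskCoeff s k : ℂ) * z ^ k :=
  MemLp.coeFn_toLp _

/-- The coefficients of a function of the Bergman space are its rescaled Taylor coefficients. -/
lemma inner_diskLp {s : ℝ} (hs : 2 ≤ s) (k : ℕ) (u : Lp ℂ 2 (diskMeasure s)) {φ : ℂ → ℂ}
    (hφ : DifferentiableOn ℂ φ (Metric.ball 0 1)) (hu : u =ᵐ[diskMeasure s] φ) :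
    inner ℂ (diskLp hs k) u = (diskCoeff s k : ℂ)⁻¹ * (iteratedDeriv k φ 0 / k.factorial) := by
  have hs1 : 1 < s := by linarith
  have hA : (diskCoeff s k : ℂ) ≠ 0 := Complex.ofReal_ne_zero.2 (diskCoeff_pos hs1 k).ne'
  have hpt : (fun z => inner ℂ (diskLp hs k z) (u z)) =ᵐ[diskMeasure s]
      fun z => (diskCoeff s k : ℂ) * (conj z ^ k * φ z) := by
    filter_upwards [coeFn_diskLp hs k, hu] with z h1 h2
    rw [h1, h2, RCLike.inner_apply, map_mul, map_pow, Complex.conj_ofReal]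
    ring
  have hint : Integrable (fun z => conj z ^ k * φ z) (diskMeasure s) := by
    have := ((L2.integrable_inner (𝕜 := ℂ) (diskLp hs k) u).congr hpt).const_mul
      (diskCoeff s k : ℂ)⁻¹
    refine this.congr (.of_forall fun z => ?_)
    simp only
    rw [inv_mul_cancel_left₀ hA]
  rw [L2.inner_def, integral_congr_ae hpt, integral_const_mul, integral_conj_pow_mul hs1 hφ k hint,
    ← mul_assoc]
  congr 1
  refine eq_inv_of_mul_eq_one_left ?_
  have hG : Real.Gamma s = (s - 1) * Real.Gamma (s - 1) := by
    rw [← Real.Gamma_add_one (by linarith), sub_add_cancel]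
  have h1 : 0 < Real.Gamma (s - 1) := Real.Gamma_pos_of_pos (by linarith)
  have h2 : 0 < Real.Gamma (s + k) := Real.Gamma_pos_of_pos (by positivity)
  have h3 : 0 < s - 1 := by linarith
  rw [← Complex.ofReal_mul, ← Complex.ofReal_mul, mul_right_comm, ← sq, diskCoeff_sq hs1, hG,
    ← Complex.ofReal_one]
  congr 1
  field_simp

lemma orthonormal_diskLp {s : ℝ} (hs : 2 ≤ s) : Orthonormal ℂ (diskLp hs) := by
  have hs1 : 1 < s := by linarith
  rw [orthonormal_iff_ite]
  intro k l
  rw [inner_diskLp hs k (diskLp hs l) (φ := fun z => (diskCoeff s l : ℂ) * z ^ l)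
    (by fun_prop) (coeFn_diskLp hs l), iteratedDeriv_const_mul_field, iteratedDeriv_fun_pow_zero]
  split_ifs with h
  · subst h
    have hA : (diskCoeff s k : ℂ) ≠ 0 := Complex.ofReal_ne_zero.2 (diskCoeff_pos hs1 k).ne'
    have hf : (k.factorial : ℂ) ≠ 0 := by exact_mod_cast k.factorial_ne_zero
    field_simp
  · simp

/-- A holomorphic function is the sum of its coefficients times the normalized monomials. -/
lemma hasSum_inner_diskLp_mul {s : ℝ} (hs : 2 ≤ s) (u : Lp ℂ 2 (diskMeasure s)) {φ : ℂ → ℂ}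
    (hφ : DifferentiableOn ℂ φ (Metric.ball 0 1)) (hu : u =ᵐ[diskMeasure s] φ) {z : ℂ}
    (hz : ‖z‖ < 1) :
    HasSum (fun k => inner ℂ (diskLp hs k) u * ((diskCoeff s k : ℂ) * z ^ k)) (φ z) := by
  have h := Complex.hasSum_taylorSeries_on_ball hφ (mem_ball_zero_iff.2 hz)
  refine h.congr_fun fun k => ?_
  have hA : (diskCoeff s k : ℂ) ≠ 0 :=
    Complex.ofReal_ne_zero.2 (diskCoeff_pos (by linarith) k).ne'
  rw [inner_diskLp hs k u hφ hu, smul_eq_mul, smul_eq_mul, sub_zero]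
  field_simp

/-! ### Orthogonal series of functions -/

lemma summable_smul_of_orthonormal {E : Type*} [NormedAddCommGroup E] [InnerProductSpace ℂ E]
    [CompleteSpace E] {v : ℕ → E} (hv : Orthonormal ℂ v) {a : ℕ → ℂ}
    (ha : Summable fun k => ‖a k‖ ^ 2) : Summable fun k => a k • v k := by
  have hmem : Memℓp a 2 := memℓp_gen (by simpa using ha)
  simpa using hv.orthogonalFamily.summable_of_lp ⟨a, hmem⟩

/-- If a series converges both in `L²` and pointwise, the two sums agree. -/
lemma ae_eq_of_hasSum_of_hasSum {α : Type*} [MeasurableSpace α] {μ : Measure α}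
    {G : ℕ → Lp ℂ 2 μ} {F : Lp ℂ 2 μ} {g : ℕ → α → ℂ} {h : α → ℂ} (hG : HasSum G F)
    (hGg : ∀ k, G k =ᵐ[μ] g k) (hg : ∀ᵐ x ∂μ, HasSum (fun k => g k x) (h x)) : F =ᵐ[μ] h := by
  obtain ⟨ns, hns, hlim⟩ :=
    (tendstoInMeasure_of_tendsto_Lp hG.tendsto_sum_nat).exists_seq_tendsto_ae
  have hsum : ∀ᵐ x ∂μ, ∀ n, (∑ k ∈ Finset.range n, G k : Lp ℂ 2 μ) x =
      ∑ k ∈ Finset.range n, g k x := by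
    refine ae_all_iff.2 fun n => ?_
    filter_upwards [Lp.coeFn_finsetSum (Finset.range n) G, ae_all_iff.2 hGg] with x h1 h2
    rw [h1, Finset.sum_apply]
    exact Finset.sum_congr rfl fun k _ => h2 k
  filter_upwards [hlim, hsum, hg] with x h1 h2 h3
  simp_rw [h2] at h1
  exact tendsto_nhds_unique h1 (h3.tendsto_sum_nat.comp hns.tendsto_atTop)

/-! ### The coherent states -/

lemma weight_zero (c : ℝ) : weight c 0 = 2 * gam c := by simp [weight]

lemma two_le_weight {c : ℝ} (hc : 0 < c) : 2 ≤ 2 * gam c := by linarith [one_lt_gam hc]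

lemma normFactor_pos {c : ℝ} (hc : 0 < c) {z : ℂ} (hz : ‖z‖ < 1) :
    0 < normFactor (2 * gam c) 0 z := by
  have h1 := one_lt_gam hc
  have h2 := pow_lt_one₀ (norm_nonneg z) hz two_ne_zero
  have h3 : 0 < (1 - ‖z‖ ^ 2) ^ (2 * gam c) := Real.rpow_pos_of_pos (by linarith) _
  rw [normFactor]
  push_cast
  exact div_pos (by linarith) (by positivity)

/-- The normalization factor `N(z)^{-1/2}` of the coherent states with `m = 0`. -/
noncomputable def coherentNorm (c : ℝ) (z : ℂ) : ℝ :=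
  normFactor (2 * gam c) 0 z ^ (-(1 / 2) : ℝ)

lemma coherentNorm_pos {c : ℝ} (hc : 0 < c) {z : ℂ} (hz : ‖z‖ < 1) : 0 < coherentNorm c z :=
  Real.rpow_pos_of_pos (normFactor_pos hc hz) _

lemma normFactor_rpow_mul_coherentNorm {c : ℝ} (hc : 0 < c) {z : ℂ} (hz : ‖z‖ < 1) :
    normFactor (2 * gam c) 0 z ^ (1 / 2 : ℝ) * coherentNorm c z = 1 := by
  rw [coherentNorm, ← Real.rpow_add (normFactor_pos hc hz)]
  simp

lemma coherentTerm_eq {c : ℝ} (hc : 0 < c) (z : ℂ) (k : ℕ) (ξ : ℝ) : coherentTerm c 0 z k ξ =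
    coherentNorm c z * conj (diskCoeff (2 * gam c) k * z ^ k) * eigenstate c k ξ := by
  rw [coherentTerm, weight_zero, landauBasis_zero (by linarith [one_lt_gam hc]), coherentNorm,
    mul_assoc]

/-- The factor in front of the integral in the explicit formula for the transform. -/
noncomputable def kernelFactor (c : ℝ) (z : ℂ) : ℂ :=
  (Real.sqrt ((2 * gam c - 1) / Real.pi) : ℂ) *
    ((-Complex.I) ^ (gam c : ℂ) / (1 - z) ^ (gam c : ℂ)) *
    ((Real.sqrt 2 / (Real.Gamma (gam c + 1 / 2) * Real.sqrt (Real.Gamma (2 * gam c))) : ℝ) : ℂ)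

lemma one_sub_ne_zero {z : ℂ} (hz : ‖z‖ < 1) : 1 - z ≠ 0 := by
  intro h
  rw [← sub_eq_zero.1 h, norm_one] at hz
  exact lt_irrefl _ hz

lemma kernelFactor_ne_zero {c : ℝ} (hc : 0 < c) {z : ℂ} (hz : ‖z‖ < 1) :
    kernelFactor c z ≠ 0 := by
  have h1 := one_lt_gam hc
  have h2 : 0 < √((2 * gam c - 1) / Real.pi) :=
    Real.sqrt_pos.2 (div_pos (by linarith) Real.pi_pos)
  have h3 : 0 < Real.Gamma (gam c + 1 / 2) := Real.Gamma_pos_of_pos (by linarith)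
  have h4 : 0 < √(Real.Gamma (2 * gam c)) := Real.sqrt_pos.2 (Real.Gamma_pos_of_pos (by linarith))
  have h5 : (-Complex.I) ^ (gam c : ℂ) ≠ 0 := by
    rw [Complex.cpow_ne_zero_iff]
    exact .inl (neg_ne_zero.2 Complex.I_ne_zero)
  have h6 : (1 - z) ^ (gam c : ℂ) ≠ 0 := by
    rw [Complex.cpow_ne_zero_iff]
    exact .inl (one_sub_ne_zero hz)
  refine mul_ne_zero (mul_ne_zero (Complex.ofReal_ne_zero.2 h2.ne') (div_ne_zero h5 h6))
    (Complex.ofReal_ne_zero.2 (ne_of_gt ?_))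
  positivity

lemma conj_eigenFactor {c : ℝ} (hc : 0 < c) (ξ : ℝ) : conj (eigenFactor c ξ) =
    (Real.sqrt 2 : ℂ) * (-Complex.I) ^ (gam c : ℂ) *
      (((c ^ 4)⁻¹ : ℝ) : ℂ) ^ (-(Complex.I * ξ)) * Complex.Gamma (gam c - Complex.I * ξ) ^ 2 *
        (Complex.Gamma (-(Complex.I * ξ)))⁻¹ := by
  have h1 : conj (Complex.I ^ (gam c : ℂ)) = (-Complex.I) ^ (gam c : ℂ) := by
    rw [← Complex.conj_I, Complex.conj_cpow _ _ (by
      rw [Complex.arg_I]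
      linarith [Real.pi_pos]), Complex.conj_ofReal]
  have h2 : conj ((((c ^ 4)⁻¹ : ℝ) : ℂ) ^ (Complex.I * ξ)) =
      (((c ^ 4)⁻¹ : ℝ) : ℂ) ^ (-(Complex.I * ξ)) := by
    have harg : (((c ^ 4)⁻¹ : ℝ) : ℂ).arg ≠ Real.pi := by
      rw [Complex.arg_ofReal_of_nonneg (by positivity)]
      exact Real.pi_ne_zero.symm
    have := Complex.conj_cpow _ (-(Complex.I * ξ)) harg
    rw [Complex.conj_ofReal] at this
    rw [this]
    simp
  have h3 : conj (Complex.Gamma (Complex.I * ξ)) = Complex.Gamma (-(Complex.I * ξ)) := by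
    rw [← Complex.Gamma_conj]
    simp
  rw [eigenFactor, map_mul, map_mul, map_mul, map_mul, h1, h2, map_pow, conj_Gamma_line, map_inv₀,
    h3, Complex.conj_ofReal]

/-- The generating function of the continuous dual Hahn polynomials sums the kernel of the
transform. -/
lemma hasSum_diskCoeff_mul_conj_eigenstate {c : ℝ} (hc : 0 < c) {z : ℂ} (hz : ‖z‖ < 1) (ξ : ℝ) :
    HasSum (fun k => (diskCoeff (2 * gam c) k : ℂ) * z ^ k * conj (eigenstate c k ξ))
      (kernelFactor c z * gaussKernel c z ξ) := by
  have hγ := one_lt_gam hc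
  have hG1 : 0 < Real.Gamma (gam c + 1 / 2) := Real.Gamma_pos_of_pos (by linarith)
  have hG2 : 0 < Real.Gamma (2 * gam c) := Real.Gamma_pos_of_pos (by linarith)
  have hz1 := one_sub_ne_zero hz
  set B : ℝ := √((2 * gam c - 1) / Real.pi) /
    (Real.Gamma (gam c + 1 / 2) * √(Real.Gamma (2 * gam c))) with hB
  have hcoef (k : ℕ) : (diskCoeff (2 * gam c) k : ℂ) / eigenNorm c k =
      B / (poch (gam c + 1 / 2) k * k.factorial) := by
    have h1 : (poch (gam c + 1 / 2) k : ℂ) =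
        ((Real.Gamma (gam c + 1 / 2 + k) / Real.Gamma (gam c + 1 / 2) : ℝ) : ℂ) := by
      rw [Complex.ofReal_div, ofReal_Gamma_add_nat (by linarith), mul_div_cancel_right₀]
      · push_cast
        rfl
      · exact Complex.ofReal_ne_zero.2 hG1.ne'
    have h2 : 0 < Real.Gamma (2 * gam c + k) := Real.Gamma_pos_of_pos (by positivity)
    have h3 : 0 < Real.Gamma (gam c + 1 / 2 + k) := Real.Gamma_pos_of_pos (by positivity)
    have h4 : 0 < (k.factorial : ℝ) := by positivity
    have h5 : 0 < 2 * gam c - 1 := by linarith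
    have h6 : diskCoeff (2 * gam c) k * k.factorial =
        √((2 * gam c - 1) / Real.pi) / √(Real.Gamma (2 * gam c)) *
          √(k.factorial * Real.Gamma (2 * gam c + k)) := by
      rw [diskCoeff, ← Real.sqrt_div (by positivity), ← Real.sqrt_mul (by positivity),
        ← Real.sqrt_mul_self h4.le, ← Real.sqrt_mul (by positivity), Real.sqrt_mul_self h4.le]
      congr 1
      field_simp
    rw [h1]
    norm_cast
    have h7 : 0 < √(k.factorial * Real.Gamma (2 * gam c + k)) := Real.sqrt_pos.2 (by positivity)
    have h8 : 0 < √(Real.Gamma (2 * gam c)) := Real.sqrt_pos.2 hG2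
    rw [eigenNorm, show (k : ℝ) + gam c + 1 / 2 = gam c + 1 / 2 + k by ring, add_comm (k : ℝ),
      div_eq_div_iff (by positivity) (by positivity)]
    rw [hB]
    calc _ = (diskCoeff (2 * gam c) k * k.factorial) *
          (Real.Gamma (gam c + 1 / 2 + k) / Real.Gamma (gam c + 1 / 2)) := by ring
      _ = _ := by
        rw [h6]
        field_simp
  have h := (hasSum_dualHahn ξ (zero_lt_one.trans hγ) (one_half_pos (α := ℝ)) hz).mul_left
    (B * conj (eigenFactor c ξ))
  convert! h using 1
  · ext k
    rw [eigenstate_eq, map_mul, map_div₀, conj_dualHahn, Complex.conj_ofReal]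
    push_cast
    calc _ = ((diskCoeff (2 * gam c) k : ℂ) / eigenNorm c k) * (z ^ k * conj (eigenFactor c ξ) *
          dualHahn k ξ (gam c) (gam c) (1 / 2)) := by ring
      _ = _ := by
        rw [hcoef]
        ring
  · have hpow : (1 - z) ^ (-(gam c + Complex.I * ξ)) =
        ((1 - z) ^ (gam c : ℂ) * (1 - z) ^ (Complex.I * ξ))⁻¹ := by
      rw [Complex.cpow_neg, Complex.cpow_add _ _ hz1]
    rw [hpow, conj_eigenFactor hc, kernelFactor, gaussKernel, hB]
    push_cast
    simp only [div_eq_mul_inv, mul_inv]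
    ring

lemma hasSum_conj_coherentTerm {c : ℝ} (hc : 0 < c) {z : ℂ} (hz : ‖z‖ < 1) (ξ : ℝ) :
    HasSum (fun k => conj (coherentTerm c 0 z k ξ))
      (coherentNorm c z * (kernelFactor c z * gaussKernel c z ξ)) := by
  refine ((hasSum_diskCoeff_mul_conj_eigenstate hc hz ξ).mul_left _).congr_fun fun k => ?_
  rw [coherentTerm_eq hc, map_mul, map_mul, Complex.conj_conj, Complex.conj_ofReal, mul_assoc]

lemma hasSum_coherentTerm {c : ℝ} (hc : 0 < c) {z : ℂ} (hz : ‖z‖ < 1) (ξ : ℝ) :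
    HasSum (fun k => coherentTerm c 0 z k ξ) (coherentState c 0 z ξ) := by
  have h := Complex.hasSum_conj.1 (hasSum_conj_coherentTerm hc hz ξ)
  exact h.summable.hasSum

lemma conj_coherentState {c : ℝ} (hc : 0 < c) {z : ℂ} (hz : ‖z‖ < 1) (ξ : ℝ) :
    conj (coherentState c 0 z ξ) = coherentNorm c z * (kernelFactor c z * gaussKernel c z ξ) :=
  (Complex.hasSum_conj'.2 (hasSum_coherentTerm hc hz ξ)).unique (hasSum_conj_coherentTerm hc hz ξ)

/-- The terms of the series of the coherent state as elements of `L²(ℝ₊)`. -/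
noncomputable def coherentTermLp {c : ℝ} (hc : 0 < c) (z : ℂ) (k : ℕ) : Lp ℂ 2 halfLine :=
  (coherentNorm c z * conj (diskCoeff (2 * gam c) k * z ^ k) : ℂ) • eigenLp hc k

lemma coeFn_coherentTermLp {c : ℝ} (hc : 0 < c) (z : ℂ) (k : ℕ) :
    coherentTermLp hc z k =ᵐ[halfLine] coherentTerm c 0 z k := by
  filter_upwards [Lp.coeFn_smul (coherentNorm c z * conj (diskCoeff (2 * gam c) k * z ^ k) : ℂ)
    (eigenLp hc k), coeFn_eigenLp hc k] with ξ h1 h2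
  rw [coherentTermLp, h1, Pi.smul_apply, h2, smul_eq_mul, coherentTerm_eq hc]

lemma summable_coherentTermLp {c : ℝ} (hc : 0 < c) {z : ℂ} (hz : ‖z‖ < 1) :
    Summable (coherentTermLp hc z) := by
  refine summable_smul_of_orthonormal (orthonormal_eigenLp hc) ?_
  refine ((summable_norm_diskCoeff_mul_pow_sq (s := 2 * gam c) (by linarith [one_lt_gam hc])
    hz).mul_left (‖(coherentNorm c z : ℂ)‖ ^ 2)).congr fun k => ?_
  rw [norm_mul _ (conj _), Complex.norm_conj, mul_pow]

/-- The coherent state as an element of `L²(ℝ₊)`. -/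
noncomputable def coherentLp {c : ℝ} (hc : 0 < c) (z : ℂ) : Lp ℂ 2 halfLine :=
  ∑' k, coherentTermLp hc z k

lemma hasSum_coherentTermLp {c : ℝ} (hc : 0 < c) {z : ℂ} (hz : ‖z‖ < 1) :
    HasSum (coherentTermLp hc z) (coherentLp hc z) :=
  (summable_coherentTermLp hc hz).hasSum

lemma coeFn_coherentLp {c : ℝ} (hc : 0 < c) {z : ℂ} (hz : ‖z‖ < 1) :
    coherentLp hc z =ᵐ[halfLine] coherentState c 0 z :=
  ae_eq_of_hasSum_of_hasSum (hasSum_coherentTermLp hc hz) (coeFn_coherentTermLp hc z)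
    (.of_forall fun ξ => hasSum_coherentTerm hc hz ξ)

lemma memLp_coherentState {c : ℝ} (hc : 0 < c) {z : ℂ} (hz : ‖z‖ < 1) :
    MemLp (coherentState c 0 z) 2 halfLine :=
  (memLp_congr_ae (coeFn_coherentLp hc hz)).1 (Lp.memLp _)

lemma tendsto_eLpNorm_coherentState_sub {c : ℝ} (hc : 0 < c) {z : ℂ} (hz : ‖z‖ < 1) :
    Tendsto (fun n : ℕ => eLpNorm (fun ξ => coherentState c 0 z ξ -
      ∑ k ∈ Finset.range n, coherentTerm c 0 z k ξ) 2 halfLine) atTop (𝓝 0) := by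
  have h := (Lp.tendsto_Lp_iff_tendsto_eLpNorm' _ _).1
    (hasSum_coherentTermLp hc hz).tendsto_sum_nat
  refine h.congr fun n => ?_
  rw [eLpNorm_sub_comm]
  refine eLpNorm_congr_ae ?_
  filter_upwards [Lp.coeFn_finsetSum (Finset.range n) (coherentTermLp hc z),
    ae_all_iff.2 (coeFn_coherentTermLp hc z), coeFn_coherentLp hc hz] with ξ h1 h2 h3
  rw [Pi.sub_apply, h1, h3, Finset.sum_apply]
  exact congrArg _ (Finset.sum_congr rfl fun k _ => h2 k)

/-! ### The coherent state transform -/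

lemma integrable_mul_conj_coherentState {c : ℝ} (hc : 0 < c) {z : ℂ} (hz : ‖z‖ < 1)
    (f : Lp ℂ 2 halfLine) :
    Integrable (fun ξ => f ξ * conj (coherentState c 0 z ξ)) halfLine :=
  (Lp.memLp f).integrable_mul (memLp_coherentState hc hz).star

lemma integrable_gaussKernel_mul {c : ℝ} (hc : 0 < c) {z : ℂ} (hz : ‖z‖ < 1)
    (f : Lp ℂ 2 halfLine) : Integrable (fun ξ => gaussKernel c z ξ * f ξ) halfLine := by
  have h1 : (coherentNorm c z : ℂ) ≠ 0 := Complex.ofReal_ne_zero.2 (coherentNorm_pos hc hz).ne'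
  have h2 := kernelFactor_ne_zero hc hz
  refine ((integrable_mul_conj_coherentState hc hz f).const_mul
    (coherentNorm c z * kernelFactor c z)⁻¹).congr (.of_forall fun ξ => ?_)
  simp only
  rw [conj_coherentState hc hz]
  field_simp

lemma bargmannTransform_eq_integral {c : ℝ} (hc : 0 < c) {z : ℂ} (hz : ‖z‖ < 1) (f : ℝ → ℂ) :
    bargmannTransform c 0 f z =
      kernelFactor c z * ∫ ξ, gaussKernel c z ξ * f ξ ∂halfLine := by
  have h (ξ : ℝ) : f ξ * conj (coherentState c 0 z ξ) =
      coherentNorm c z * (kernelFactor c z * (gaussKernel c z ξ * f ξ)) := by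
    rw [conj_coherentState hc hz]
    ring
  simp_rw [bargmannTransform, weight_zero, h]
  rw [integral_const_mul, integral_const_mul, ← mul_assoc, ← Complex.ofReal_mul,
    normFactor_rpow_mul_coherentNorm hc hz, Complex.ofReal_one, one_mul]

/-- The transform maps the eigenstates to the normalized monomials. -/
lemma hasSum_bargmannTransform {c : ℝ} (hc : 0 < c) {z : ℂ} (hz : ‖z‖ < 1)
    (f : Lp ℂ 2 halfLine) :
    HasSum (fun k => inner ℂ (eigenLp hc k) f * ((diskCoeff (2 * gam c) k : ℂ) * z ^ k))
      (bargmannTransform c 0 f z) := by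
  have h1 : bargmannTransform c 0 f z =
      ((normFactor (2 * gam c) 0 z ^ (1 / 2 : ℝ) : ℝ) : ℂ) * inner ℂ (coherentLp hc z) f := by
    rw [bargmannTransform, weight_zero, L2.inner_def]
    congr 1
    refine integral_congr_ae ?_
    filter_upwards [coeFn_coherentLp hc hz] with ξ hξ
    rw [hξ, RCLike.inner_apply]
  have h2 : HasSum (fun k => inner ℂ (coherentTermLp hc z k) f) (inner ℂ (coherentLp hc z) f) := by
    have := ((innerSL ℂ).flip f).hasSum (hasSum_coherentTermLp hc hz)
    exact this
  rw [h1]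
  refine (h2.mul_left _).congr_fun fun k => ?_
  have h3 : ((normFactor (2 * gam c) 0 z ^ (1 / 2 : ℝ) : ℝ) : ℂ) * coherentNorm c z = 1 := by
    rw [← Complex.ofReal_mul, normFactor_rpow_mul_coherentNorm hc hz, Complex.ofReal_one]
  rw [coherentTermLp, inner_smul_left, map_mul, Complex.conj_conj, Complex.conj_ofReal]
  linear_combination
    (-(inner ℂ (eigenLp hc k) f * ((diskCoeff (2 * gam c) k : ℂ) * z ^ k))) * h3

/-- A series of normalized monomials with square summable coefficients is holomorphic. -/
lemma differentiableOn_of_hasSum {s : ℝ} (hs : 1 < s) {a : ℕ → ℂ}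
    (ha : Summable fun k => ‖a k‖ ^ 2) {φ : ℂ → ℂ}
    (hφ : ∀ z, ‖z‖ < 1 → HasSum (fun k => a k * ((diskCoeff s k : ℂ) * z ^ k)) (φ z)) :
    DifferentiableOn ℂ φ (Metric.ball 0 1) := by
  intro z hz
  obtain ⟨r, hzr, hr⟩ := exists_between (mem_ball_zero_iff.1 hz)
  have hr0 : 0 ≤ r := (norm_nonneg z).trans hzr.le
  have hu := ha.add (summable_diskCoeff_sq_mul_pow hs (sq_nonneg r)
    (pow_lt_one₀ hr0 hr two_ne_zero))
  have h := Complex.differentiableOn_tsum_of_summable_norm (U := Metric.ball 0 r)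
    (F := fun k w => a k * ((diskCoeff s k : ℂ) * w ^ k)) hu (fun k => by fun_prop)
    Metric.isOpen_ball (fun k w hw => by
      have hw' : ‖w‖ ≤ r := (mem_ball_zero_iff.1 hw).le
      have h1 : ‖w‖ ^ k ≤ r ^ k := by gcongr
      have hA := (diskCoeff_pos hs k).le
      rw [norm_mul, norm_mul, norm_pow, Complex.norm_real, Real.norm_of_nonneg hA]
      calc ‖a k‖ * (diskCoeff s k * ‖w‖ ^ k) ≤ ‖a k‖ * (diskCoeff s k * r ^ k) := by gcongr
        _ ≤ ‖a k‖ ^ 2 + (diskCoeff s k * r ^ k) ^ 2 := by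
          nlinarith [sq_nonneg (‖a k‖ - diskCoeff s k * r ^ k), sq_nonneg ‖a k‖,
            sq_nonneg (diskCoeff s k * r ^ k)]
        _ = _ := by ring)
  have hmem : Metric.ball (0 : ℂ) r ∈ 𝓝 z :=
    Metric.isOpen_ball.mem_nhds (mem_ball_zero_iff.2 hzr)
  refine ((h.differentiableAt hmem).congr_of_eventuallyEq ?_).differentiableWithinAt
  filter_upwards [hmem] with w hw
  exact (hφ w ((mem_ball_zero_iff.1 hw).trans hr)).tsum_eq.symm

lemma differentiableOn_bargmannTransform {c : ℝ} (hc : 0 < c) (f : Lp ℂ 2 halfLine) :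
    DifferentiableOn ℂ (bargmannTransform c 0 f) (Metric.ball 0 1) :=
  differentiableOn_of_hasSum (by linarith [one_lt_gam hc])
    ((orthonormal_eigenLp hc).inner_products_summable f) fun _ hz => hasSum_bargmannTransform hc hz f

/-! ### The isometry onto the Bergman space -/

/-- The isometry of `L²(ℝ₊)` into `L²` of the disk that maps the eigenstates to the normalized
monomials. -/
noncomputable def transformIsometry {c : ℝ} (hc : 0 < c) :
    Lp ℂ 2 halfLine →ₗᵢ[ℂ] Lp ℂ 2 (diskMeasure (2 * gam c)) :=
  (orthonormal_diskLp (two_le_weight hc)).orthogonalFamily.linearIsometry.comp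
    (eigenBasis hc).repr.toLinearIsometry

lemma hasSum_transformIsometry {c : ℝ} (hc : 0 < c) (f : Lp ℂ 2 halfLine) :
    HasSum (fun k => (inner ℂ (eigenLp hc k) f : ℂ) • diskLp (two_le_weight hc) k)
      (transformIsometry hc f) := by
  have h := (orthonormal_diskLp (two_le_weight hc)).orthogonalFamily.hasSum_linearIsometry
    ((eigenBasis hc).repr f)
  refine h.congr_fun fun k => ?_
  rw [HilbertBasis.repr_apply_apply, coe_eigenBasis, LinearIsometry.toSpanSingleton_apply]

lemma coeFn_transformIsometry {c : ℝ} (hc : 0 < c) (f : Lp ℂ 2 halfLine) :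
    transformIsometry hc f =ᵐ[diskMeasure (2 * gam c)] bargmannTransform c 0 f := by
  refine ae_eq_of_hasSum_of_hasSum (hasSum_transformIsometry hc f)
    (g := fun k z => inner ℂ (eigenLp hc k) f * ((diskCoeff (2 * gam c) k : ℂ) * z ^ k))
    (fun k => ?_) ?_
  · filter_upwards [Lp.coeFn_smul (inner ℂ (eigenLp hc k) f : ℂ) (diskLp (two_le_weight hc) k),
      coeFn_diskLp (two_le_weight hc) k] with z h1 h2
    rw [h1, Pi.smul_apply, h2, smul_eq_mul]
  · filter_upwards [ae_diskMeasure_norm_lt_one (2 * gam c)] with z hz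
    exact hasSum_bargmannTransform hc hz f

/-- Every function of the Bergman space is the transform of the function with the same
coefficients. -/
lemma exists_transformIsometry_eq {c : ℝ} (hc : 0 < c) {u : Lp ℂ 2 (diskMeasure (2 * gam c))}
    (hu : u ∈ bergmanSpace (2 * gam c)) : ∃ f, transformIsometry hc f = u := by
  obtain ⟨φ, hφ, huφ⟩ := hu
  have hs := two_le_weight hc
  have hmem : Memℓp (fun k => inner ℂ (diskLp hs k) u) 2 :=
    memℓp_gen (by simpa using (orthonormal_diskLp hs).inner_products_summable u)
  refine ⟨(eigenBasis hc).repr.symm ⟨_, hmem⟩, Lp.ext ?_⟩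
  refine (coeFn_transformIsometry hc _).trans (EventuallyEq.trans ?_ huφ.symm)
  filter_upwards [ae_diskMeasure_norm_lt_one (2 * gam c)] with z hz
  refine (hasSum_bargmannTransform hc hz _).unique
    ((hasSum_inner_diskLp_mul hs u hφ huφ hz).congr_fun fun k => ?_)
  rw [← coe_eigenBasis hc, ← HilbertBasis.repr_apply_apply, LinearIsometryEquiv.apply_symm_apply]

/-- The coherent state transform as a unitary map onto the Bergman space. -/
noncomputable def transformEquiv {c : ℝ} (hc : 0 < c) :
    Lp ℂ 2 halfLine ≃ₗᵢ[ℂ] bergmanSpace (2 * gam c) :=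
  LinearIsometryEquiv.ofSurjective
    { toLinearMap := (transformIsometry hc).toLinearMap.codRestrict (bergmanSpace (2 * gam c))
        fun f => ⟨_, differentiableOn_bargmannTransform hc f, coeFn_transformIsometry hc f⟩
      norm_map' := fun f => (transformIsometry hc).norm_map f }
    fun u => by
      obtain ⟨f, hf⟩ := exists_transformIsometry_eq hc u.2
      exact ⟨f, Subtype.ext hf⟩

lemma coeFn_transformEquiv {c : ℝ} (hc : 0 < c) (f : Lp ℂ 2 halfLine) :
    ((transformEquiv hc f : Lp ℂ 2 (diskMeasure (2 * gam c))) : ℂ → ℂ)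
      =ᵐ[diskMeasure (2 * gam c)] bargmannTransform c 0 f :=
  coeFn_transformIsometry hc f

end RelativisticBargmann

theorem corollary6p1 (c : ℝ) (hc : 0 < c) :
    -- the coherent states with `m = 0` are well defined, pointwise and in `L²(ℝ₊)`
    (∀ z ∈ Metric.ball (0 : ℂ) 1,
      (∀ ξ ∈ Ioi (0 : ℝ), Summable fun k => RelativisticBargmann.coherentTerm c 0 z k ξ) ∧
      MemLp (RelativisticBargmann.coherentState c 0 z) 2 RelativisticBargmann.halfLine ∧
      Tendsto (fun n : ℕ => eLpNorm (fun ξ => RelativisticBargmann.coherentState c 0 z ξ -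
          ∑ k ∈ Finset.range n, RelativisticBargmann.coherentTerm c 0 z k ξ) 2
          RelativisticBargmann.halfLine) atTop (𝓝 0)) ∧
    -- the explicit form of the transform
    (∀ f : Lp ℂ 2 RelativisticBargmann.halfLine, ∀ z ∈ Metric.ball (0 : ℂ) 1,
      Integrable (fun ξ => RelativisticBargmann.gaussKernel c z ξ * f ξ)
        RelativisticBargmann.halfLine ∧
      RelativisticBargmann.bargmannTransform c 0 f z =
        (Real.sqrt ((2 * RelativisticBargmann.gam c - 1) / Real.pi) : ℂ) *
          ((-Complex.I) ^ (RelativisticBargmann.gam c : ℂ) /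
            (1 - z) ^ (RelativisticBargmann.gam c : ℂ)) *
          ((Real.sqrt 2 / (Real.Gamma (RelativisticBargmann.gam c + 1 / 2) *
            Real.sqrt (Real.Gamma (2 * RelativisticBargmann.gam c))) : ℝ) : ℂ) *
          ∫ ξ, RelativisticBargmann.gaussKernel c z ξ * f ξ ∂(RelativisticBargmann.halfLine)) ∧
    -- the transform takes holomorphic values and is a linear isometry onto the Bergman space
    (∀ f : Lp ℂ 2 RelativisticBargmann.halfLine,
      DifferentiableOn ℂ (RelativisticBargmann.bargmannTransform c 0 f) (Metric.ball (0 : ℂ) 1)) ∧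
    ∃ U : Lp ℂ 2 RelativisticBargmann.halfLine ≃ₗᵢ[ℂ]
        RelativisticBargmann.bergmanSpace (2 * RelativisticBargmann.gam c),
      ∀ f : Lp ℂ 2 RelativisticBargmann.halfLine,
        ((U f : Lp ℂ 2 (RelativisticBargmann.diskMeasure (2 * RelativisticBargmann.gam c))) :
            ℂ → ℂ) =ᵐ[RelativisticBargmann.diskMeasure (2 * RelativisticBargmann.gam c)]
          RelativisticBargmann.bargmannTransform c 0 f := by
  open RelativisticBargmann in
  refine ⟨fun z hz => ?_, fun f z hz => ?_, differentiableOn_bargmannTransform hc,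
    transformEquiv hc, coeFn_transformEquiv hc⟩
  · have hz' := mem_ball_zero_iff.1 hz
    exact ⟨fun ξ _ => (hasSum_coherentTerm hc hz' ξ).summable, memLp_coherentState hc hz',
      tendsto_eLpNorm_coherentState_sub hc hz'⟩
  · have hz' := mem_ball_zero_iff.1 hz
    exact ⟨integrable_gaussKernel_mul hc hz' f, bargmannTransform_eq_integral hc hz' f⟩
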